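/- For real $\alpha>0$ and $x>1$ put $$\sigma=\frac{\alpha}{\ln x},\qquad \tau=\alpha\,\frac{\ln\ln x}{\ln x},$$ and consider the series $$u(\sigma,\tau)=\sum_{n=1}^\infty\ \sum_{m=1}^n (-1)^{n-m}\begin{bmatrix} n\\ n-m+1\end{bmatrix}\frac{\sigma^{n-m}\tau^m}{m!},\qquad (*)$$ where $\begin{bmatrix} n\\ k\end{bmatrix}$ is the unsigned Stirling number of the first kind (Stirling cycle number). Convergence means convergence of the partial sums over $n$ of the inner finite sums; divergence means failure of convergence. For $\alpha>1$ the equation $\eta_0\cot\eta_0=1-\ln\alpha$ has exactly one root $\eta_0\in(0,\pi)$. Set $$x_\alpha=\begin{cases}(e/\alpha)^\alpha, & 0<\alpha\le 1,\\ e^{\alpha\eta_0\csc\eta_0}, & \alpha>1.\end{cases}$$ Then $x_\alpha>1$ for every $\alpha>0$, and: (i) the series $(*)$ converges for every $x>x_\alpha$; (ii) the series $(*)$ diverges for every $x$ with $1<x<x_\alpha$ and $x\ne e$. (At $x=e$ one has $\tau=0$, so for every $\alpha>0$ all terms of $(*)$, i.e. all the inner sums, are zero and the series converges trivially.) In particular,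 for $\alpha=1$ (the case of the Lambert $W$ function) one has $x_1=e$: the series $(*)$ converges for $x>e$ and diverges for $1<x<e$. -/

import Mathlib

open Real Filter Topology

/-- The `n`-th term (`n ≥ 1`) of the series for `u(σ, τ)`: the inner finite sum over `1 ≤ m ≤ n`.
`Nat.stirlingFirst` is the unsigned Stirling number of the first kind (Stirling cycle number). -/
noncomputable def comtetTerm (σ τ : ℝ) (n : ℕ) : ℝ :=
  ∑ m ∈ Finset.Icc 1 n,
    (-1 : ℝ) ^ (n - m) * (Nat.stirlingFirst n (n - m + 1) : ℝ)
      * (σ ^ (n - m) * τ ^ m / (Nat.factorial m : ℝ))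

/-- `σ = α / ln x`. -/
noncomputable def comtetSigma (α x : ℝ) : ℝ := α / log x

/-- `τ = α ln ln x / ln x`. -/
noncomputable def comtetTau (α x : ℝ) : ℝ := α * log (log x) / log x

/-- The series `∑_{n ≥ 1} ∑_{m = 1}^n …` at the point `x`, with parameter `α`, is convergent:
its partial sums over `1 ≤ n ≤ N` have a finite limit. It is divergent if this fails. -/
def ComtetConverges (α x : ℝ) : Prop :=
  ∃ s : ℝ, Tendsto
    (fun N : ℕ => ∑ n ∈ Finset.Icc 1 N, comtetTerm (comtetSigma α x) (comtetTau α x) n)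
    atTop (𝓝 s)

/-- `η₀` is a root of `η cot η = 1 - ln α` in the interval `(0, π)`. -/
def IsEtaRoot (α η₀ : ℝ) : Prop :=
  0 < η₀ ∧ η₀ < π ∧ η₀ * cot η₀ = 1 - log α

/-- The threshold `x_α`; `η₀` matters only when `α > 1`. -/
noncomputable def comtetThreshold (α η₀ : ℝ) : ℝ :=
  if α ≤ 1 then (exp 1 / α) ^ α else exp (α * (η₀ * (sin η₀)⁻¹))

/-!
Put `L = log x`, `p = log L`, so that `σ = α / L` and `τ = σ p`. In the variable `s = p - u` the
series `u(σ, τ)` solves `exp (s - p) = 1 - σ s`, that is, `y = 1 + ε (p + log y)` with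
`y = exp (s - p)` and `ε = -σ`. Its `n`-th term is `± σⁿ aₙ / (n + 1)`, where `aₙ` is the Taylor
coefficient `Dⁿ (p + log y)^(n+1) / n!` at `y = 1` (`comtetTerm_eq`, by the recurrence of the
Stirling numbers). Hence only the radius of convergence `R` of `∑ aₙ εⁿ` matters, which depends on
`L` alone: the series converges for `σ < R` and diverges for `σ > R`.

The function `ε(s) = (exp (s - p) - 1) / s` has its critical points at `s = 1 - v` with
`v exp (1 - v) = L`, and there `|ε| = 1 / |v|`. The radius is `R = 1 / |v|`, with `v > 1` real if
`L < 1`, and with `v = b cot b ± b i`, `0 < b < π`, `R = sin b / b`, if `L > 1`.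

Divergence for `σ > R` (`false_of_critical_point`). By Lagrange inversion the sum `K(ε) = ∑ aₙ εⁿ`
satisfies `K(ε(s)) ε'(s) = exp (s - p)` near `s = p`. If the series converged, `K` would be analytic
on `|ε| < σ`, and the identity would persist along any path from `p` on which `|ε| < σ`. There is
such a path to the critical point, and there `ε' = 0`: a contradiction.

Convergence for `σ < R`. If `L > 1`, then `aₙ` is, up to a constant, the integral of
`ε(s)^(-n-1) exp (s - p)` along the boundary of the rectangle `[0, A] × [-b, b]`
(`rectIntegral_exp_eq`), on which `|ε| ≥ R`. The horizontal edges pass through the critical points,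
and the bound there reduces to `exp t ≥ 1 + t`. If `L < 1`, Cauchy's estimate on the circle `|y - 1| = 1 - α / L` is enough.

Finally `b ↦ b cot b` decreases strictly on `(0, π)` and `L` increases with `b`, so that comparing
`σ` with `R` amounts to comparing `b` with `η₀`, that is, `x` with `x_α`.
-/

/-! ### The terms of the series as Taylor coefficients -/

/-- The Taylor coefficient `D^n (p + log y)^(n+1) / n!` at `y = 1`. These are the coefficients that
Lagrange inversion attaches to the equation `y = 1 + ε (p + log y)`: its solution has derivative
`∑ aₙ εⁿ` with respect to `ε`. -/
noncomputable def lagrangeCoeff (p : ℂ) (n : ℕ) : ℂ :=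
  iteratedDeriv n (fun y : ℂ => (p + Complex.log y) ^ (n + 1)) 1 / (n.factorial : ℂ)

lemma hasDerivAt_add_log_pow (p : ℂ) (N : ℕ) {y : ℂ} (hy : y ∈ Complex.slitPlane) :
    HasDerivAt (fun y : ℂ => (p + Complex.log y) ^ N)
      (N * (p + Complex.log y) ^ (N - 1) * y⁻¹) y :=
  ((Complex.hasDerivAt_log hy).const_add p).pow N

/-- Since `(y D)(y D - 1) ⋯ (y D - n + 1) = yⁿ Dⁿ`, the Stirling cycle numbers express the
derivatives of a function of `log y`. -/
lemma iteratedDeriv_add_log_pow (p : ℂ) (N n : ℕ) :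
    ∀ y ∈ Complex.slitPlane, iteratedDeriv n (fun y : ℂ => (p + Complex.log y) ^ N) y =
      (∑ k ∈ Finset.range (n + 1), (-1 : ℂ) ^ (n + k) * (Nat.stirlingFirst n k : ℂ)
        * (N.descFactorial k : ℂ) * (p + Complex.log y) ^ (N - k)) / y ^ n := by
  induction n with
  | zero => intro y _; simp
  | succ n ih =>
    intro y hy
    have hy0 : y ≠ 0 := Complex.slitPlane_ne_zero hy
    rw [iteratedDeriv_succ, (Filter.eventuallyEq_of_mem (Complex.isOpen_slitPlane.mem_nhds hy) ih
      ).deriv_eq]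
    have hS : HasDerivAt (fun y : ℂ => ∑ k ∈ Finset.range (n + 1), (-1 : ℂ) ^ (n + k)
        * (Nat.stirlingFirst n k : ℂ) * (N.descFactorial k : ℂ) * (p + Complex.log y) ^ (N - k))
        (∑ k ∈ Finset.range (n + 1), (-1 : ℂ) ^ (n + k)
        * (Nat.stirlingFirst n k : ℂ) * (N.descFactorial k : ℂ) *
          (((N - k : ℕ) : ℂ) * (p + Complex.log y) ^ (N - k - 1) * y⁻¹)) y :=
      HasDerivAt.fun_sum fun k _ => (hasDerivAt_add_log_pow p (N - k) hy).const_mul _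
    rw [(hS.fun_div (hasDerivAt_pow n y) (pow_ne_zero n hy0)).deriv]
    have hsum : ∑ k ∈ Finset.range (n + 1), (-1 : ℂ) ^ (n + k)
        * (Nat.stirlingFirst n k : ℂ) * (N.descFactorial k : ℂ) *
          (((N - k : ℕ) : ℂ) * (p + Complex.log y) ^ (N - k - 1) * y⁻¹)
        = y⁻¹ * ∑ k ∈ Finset.range (n + 1), (-1 : ℂ) ^ (n + k) * (Nat.stirlingFirst n k : ℂ)
          * (N.descFactorial (k + 1) : ℂ) * (p + Complex.log y) ^ (N - (k + 1)) := by
      rw [Finset.mul_sum]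
      refine Finset.sum_congr rfl fun k _ => ?_
      rw [Nat.descFactorial_succ, Nat.sub_sub]
      push_cast
      ring
    have hrec : ∑ k ∈ Finset.range (n + 1 + 1), (-1 : ℂ) ^ (n + 1 + k)
        * (Nat.stirlingFirst (n + 1) k : ℂ)
        * (N.descFactorial k : ℂ) * (p + Complex.log y) ^ (N - k)
        = (∑ k ∈ Finset.range (n + 1), (-1 : ℂ) ^ (n + k) * (Nat.stirlingFirst n k : ℂ)
          * (N.descFactorial (k + 1) : ℂ) * (p + Complex.log y) ^ (N - (k + 1)))
        - n * ∑ k ∈ Finset.range (n + 1), (-1 : ℂ) ^ (n + k) * (Nat.stirlingFirst n k : ℂ)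
          * (N.descFactorial k : ℂ) * (p + Complex.log y) ^ (N - k) := by
      have hz : (n : ℂ) * (Nat.stirlingFirst n 0 : ℂ) = 0 := by cases n <;> simp
      have hext : (n : ℂ) * ∑ k ∈ Finset.range (n + 1), (-1 : ℂ) ^ (n + k)
            * (Nat.stirlingFirst n k : ℂ)
            * (N.descFactorial k : ℂ) * (p + Complex.log y) ^ (N - k)
          = ∑ k ∈ Finset.range (n + 1), (n : ℂ) * ((-1 : ℂ) ^ (n + (k + 1))
            * (Nat.stirlingFirst n (k + 1) : ℂ)
            * (N.descFactorial (k + 1) : ℂ) * (p + Complex.log y) ^ (N - (k + 1))) := by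
        have h1 := Finset.sum_range_succ (fun k => (-1 : ℂ) ^ (n + k)
            * (Nat.stirlingFirst n k : ℂ)
            * (N.descFactorial k : ℂ) * (p + Complex.log y) ^ (N - k)) (n + 1)
        rw [Finset.sum_range_succ', Nat.stirlingFirst_eq_zero_of_lt (Nat.lt_succ_self n)] at h1
        simp only [Nat.cast_zero, mul_zero, zero_mul, add_zero] at h1
        rw [← h1, mul_add, Finset.mul_sum]
        have : (n : ℂ) * ((-1 : ℂ) ^ n * (Nat.stirlingFirst n 0 : ℂ) *
          (N.descFactorial 0 : ℂ) * (p + Complex.log y) ^ (N - 0)) = 0 := by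
          linear_combination ((-1 : ℂ) ^ n * (N.descFactorial 0 : ℂ) *
            (p + Complex.log y) ^ (N - 0)) * hz
        rw [this, add_zero]
      rw [hext, Finset.sum_range_succ', ← Finset.sum_sub_distrib, Nat.stirlingFirst_succ_zero]
      simp only [Nat.cast_zero, mul_zero, zero_mul, add_zero]
      refine Finset.sum_congr rfl fun k _ => ?_
      rw [Nat.stirlingFirst_succ_succ]
      push_cast
      ring
    rw [hsum, hrec]
    cases n with
    | zero => simp; field_simp
    | succ n =>
      simp only [Nat.add_sub_cancel]
      field_simp
      ring

lemma lagrangeCoeff_eq_sum (p : ℂ) {n : ℕ} (hn : 1 ≤ n) :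
    lagrangeCoeff p n = ∑ m ∈ Finset.Icc 1 n, (n + 1 : ℂ) * ((-1 : ℂ) ^ (m + 1)
      * (Nat.stirlingFirst n (n - m + 1) : ℂ) * (p ^ m / (m.factorial : ℂ))) := by
  rw [lagrangeCoeff, iteratedDeriv_add_log_pow p (n + 1) n 1 Complex.one_mem_slitPlane,
    Finset.sum_range_succ']
  obtain ⟨N, rfl⟩ : ∃ N, n = N + 1 := ⟨n - 1, by omega⟩
  simp only [Nat.stirlingFirst_succ_zero, Complex.log_one, add_zero, one_pow, div_one,
    Nat.cast_zero, mul_zero, zero_mul]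
  rw [Finset.sum_div]
  refine Finset.sum_bij' (fun k _ => N + 1 - k) (fun m _ => N + 1 - m) ?_ ?_ ?_ ?_ ?_
  · intro k hk; simp only [Finset.mem_range, Finset.mem_Icc] at *; omega
  · intro k hk; simp only [Finset.mem_range, Finset.mem_Icc] at *; omega
  · intro k hk; simp only [Finset.mem_range] at *; omega
  · intro k hk; simp only [Finset.mem_Icc] at *; omega
  · intro k hk
    simp only [Finset.mem_range] at hk
    obtain ⟨j, hj⟩ : ∃ j, N + 1 = k + j := ⟨N + 1 - k, by omega⟩
    have e1 : N + 1 - k = j := by omega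
    have e2 : N + 1 - j + 1 = k + 1 := by omega
    have e3 : N + 1 + 1 - (k + 1) = j := by omega
    have hd : (j.factorial : ℂ) * ((N + 1 + 1).descFactorial (k + 1) : ℂ)
        = (N + 1 + 1 : ℂ) * ((N + 1).factorial : ℂ) := by
      have := Nat.factorial_mul_descFactorial (show k + 1 ≤ N + 1 + 1 by omega)
      rw [e3, Nat.factorial_succ (N + 1)] at this
      exact_mod_cast this
    have hs : (-1 : ℂ) ^ (N + 1 + (k + 1)) = (-1) ^ (j + 1) := by
      rw [hj, show k + j + (k + 1) = 2 * k + (j + 1) by ring, pow_add, pow_mul]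
      simp
    have f1 : (j.factorial : ℂ) ≠ 0 := by exact_mod_cast j.factorial_ne_zero
    have f2 : ((N + 1).factorial : ℂ) ≠ 0 := by exact_mod_cast (N + 1).factorial_ne_zero
    rw [e1, e2, e3, hs]
    field_simp
    push_cast
    linear_combination ((Nat.stirlingFirst (N + 1) (k + 1) : ℂ) * p ^ j) * hd

lemma comtetTerm_eq (σ p : ℝ) {n : ℕ} (hn : 1 ≤ n) :
    ((comtetTerm σ (σ * p) n : ℝ) : ℂ) =
      (-1 : ℂ) ^ (n + 1) * (σ : ℂ) ^ n * (lagrangeCoeff p n / (n + 1)) := by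
  have hn1 : (n + 1 : ℂ) ≠ 0 := by exact_mod_cast n.succ_ne_zero
  rw [lagrangeCoeff_eq_sum _ hn, ← Finset.mul_sum, mul_div_cancel_left₀ _ hn1, comtetTerm,
    Finset.mul_sum]
  push_cast
  refine Finset.sum_congr rfl fun m hm => ?_
  obtain ⟨j, rfl⟩ : ∃ j, n = m + j := ⟨n - m, by have := (Finset.mem_Icc.1 hm).2; omega⟩
  rw [Nat.add_sub_cancel_left, mul_pow, pow_add (σ : ℂ)]
  have : (-1 : ℂ) ^ (m + j + 1) * (-1) ^ (m + 1) = (-1) ^ j := by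
    rw [← pow_add, show m + j + 1 + (m + 1) = 2 * (m + 1) + j by ring, pow_add, pow_mul]
    simp
  rw [← this]
  ring

lemma abs_comtetTerm (σ p : ℝ) (hσ : 0 ≤ σ) {n : ℕ} (hn : 1 ≤ n) :
    |comtetTerm σ (σ * p) n| = σ ^ n * (‖lagrangeCoeff p n‖ / (n + 1)) := by
  have h := congrArg norm (comtetTerm_eq σ p hn)
  rw [Complex.norm_real, Real.norm_eq_abs] at h
  rw [h]
  have : ‖(n + 1 : ℂ)‖ = n + 1 := by exact_mod_cast Complex.norm_natCast (n + 1)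
  simp [this, abs_of_nonneg hσ]

/-! ### Integrals along the boundary of a rectangle -/

/-- The integral of `f` along the boundary of the rectangle `[0, A] × [-b, b]`, counterclockwise. -/
noncomputable def rectIntegral (A b : ℝ) (f : ℂ → ℂ) : ℂ :=
  (∫ x : ℝ in (0 : ℝ)..A, f (x + (-b : ℝ) * Complex.I))
    - (∫ x : ℝ in (0 : ℝ)..A, f (x + (b : ℝ) * Complex.I))
    + Complex.I * (∫ y : ℝ in (-b)..b, f ((A : ℝ) + y * Complex.I))
    - Complex.I * (∫ y : ℝ in (-b)..b, f ((0 : ℝ) + y * Complex.I))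

/-- The boundary of the rectangle `[0, A] × [-b, b]`. -/
def rectBoundary (A b : ℝ) : Set ℂ :=
  {s | (s.re ∈ Set.Icc 0 A ∧ (s.im = -b ∨ s.im = b)) ∨
    ((s.re = 0 ∨ s.re = A) ∧ s.im ∈ Set.Icc (-b) b)}

section rect

variable {A b : ℝ} {f g F : ℂ → ℂ}

lemma horizontal_mem_rectBoundary {x c : ℝ} (hx : x ∈ Set.Icc 0 A) (hc : c = -b ∨ c = b) :
    (x + (c : ℝ) * Complex.I : ℂ) ∈ rectBoundary A b := by
  left; simpa using ⟨hx, hc⟩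

lemma vertical_mem_rectBoundary {y c : ℝ} (hy : y ∈ Set.Icc (-b) b) (hc : c = 0 ∨ c = A) :
    ((c : ℝ) + y * Complex.I : ℂ) ∈ rectBoundary A b := by
  right; simpa using ⟨hc, hy⟩

lemma abs_im_le_of_mem_rectBoundary (hb : 0 ≤ b) {s : ℂ} (hs : s ∈ rectBoundary A b) :
    |s.im| ≤ b := by
  rcases hs with ⟨-, h | h⟩ | ⟨-, h⟩
  · rw [h, abs_neg, abs_of_nonneg hb]
  · rw [h, abs_of_nonneg hb]
  · exact abs_le.2 h

lemma ne_of_mem_rectBoundary {p : ℝ} (hb : 0 < b) (hp : 0 < p) (hpA : p < A) {s : ℂ}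
    (hs : s ∈ rectBoundary A b) : s ≠ p := by
  rintro rfl
  rcases hs with ⟨-, h | h⟩ | ⟨h | h, -⟩ <;> simp at h <;> linarith

lemma intervalIntegrable_horizontal (hA : 0 ≤ A) (hf : ContinuousOn f (rectBoundary A b)) {c : ℝ}
    (hc : c = -b ∨ c = b) :
    IntervalIntegrable (fun x : ℝ => f (x + (c : ℝ) * Complex.I)) MeasureTheory.volume 0 A := by
  refine ContinuousOn.intervalIntegrable_of_Icc hA (hf.comp (by fun_prop) fun x hx => ?_)
  exact horizontal_mem_rectBoundary hx hc

lemma intervalIntegrable_vertical (hb : 0 ≤ b) (hf : ContinuousOn f (rectBoundary A b)) {c : ℝ}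
    (hc : c = 0 ∨ c = A) :
    IntervalIntegrable (fun y : ℝ => f ((c : ℝ) + y * Complex.I)) MeasureTheory.volume (-b) b := by
  refine ContinuousOn.intervalIntegrable_of_Icc (by linarith)
    (hf.comp (by fun_prop) fun x hx => ?_)
  exact vertical_mem_rectBoundary hx hc

lemma rectIntegral_add (hA : 0 ≤ A) (hb : 0 ≤ b) (hf : ContinuousOn f (rectBoundary A b))
    (hg : ContinuousOn g (rectBoundary A b)) :
    rectIntegral A b (fun s => f s + g s) = rectIntegral A b f + rectIntegral A b g := by
  unfold rectIntegral
  rw [intervalIntegral.integral_add (intervalIntegrable_horizontal hA hf (.inl rfl))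
      (intervalIntegrable_horizontal hA hg (.inl rfl)),
    intervalIntegral.integral_add (intervalIntegrable_horizontal hA hf (.inr rfl))
      (intervalIntegrable_horizontal hA hg (.inr rfl)),
    intervalIntegral.integral_add (intervalIntegrable_vertical hb hf (.inl rfl))
      (intervalIntegrable_vertical hb hg (.inl rfl)),
    intervalIntegral.integral_add (intervalIntegrable_vertical hb hf (.inr rfl))
      (intervalIntegrable_vertical hb hg (.inr rfl))]
  ring

lemma rectIntegral_const_mul (c : ℂ) (f : ℂ → ℂ) :
    rectIntegral A b (fun s => c * f s) = c * rectIntegral A b f := by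
  unfold rectIntegral
  simp only [intervalIntegral.integral_const_mul]
  ring

lemma rectIntegral_congr (hA : 0 ≤ A) (hb : 0 ≤ b) (h : Set.EqOn f g (rectBoundary A b)) :
    rectIntegral A b f = rectIntegral A b g := by
  have hb' : -b ≤ b := by linarith
  have e1 : ∀ c : ℝ, c = -b ∨ c = b → (∫ x : ℝ in (0 : ℝ)..A, f (x + (c : ℝ) * Complex.I))
      = ∫ x : ℝ in (0 : ℝ)..A, g (x + (c : ℝ) * Complex.I) := fun c hc =>
    intervalIntegral.integral_congr fun x hx =>
      h (horizontal_mem_rectBoundary (by rwa [Set.uIcc_of_le hA] at hx) hc)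
  have e2 : ∀ c : ℝ, c = 0 ∨ c = A → (∫ y : ℝ in (-b)..b, f ((c : ℝ) + y * Complex.I))
      = ∫ y : ℝ in (-b)..b, g ((c : ℝ) + y * Complex.I) := fun c hc =>
    intervalIntegral.integral_congr fun x hx =>
      h (vertical_mem_rectBoundary (by rwa [Set.uIcc_of_le hb'] at hx) hc)
  rw [rectIntegral, rectIntegral, e1 _ (.inl rfl), e1 _ (.inr rfl), e2 _ (.inl rfl),
    e2 _ (.inr rfl)]

lemma norm_rectIntegral_le (hA : 0 ≤ A) (hb : 0 ≤ b) {C : ℝ}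
    (h : ∀ s ∈ rectBoundary A b, ‖f s‖ ≤ C) :
    ‖rectIntegral A b f‖ ≤ C * (2 * A + 4 * b) := by
  have hb' : -b ≤ b := by linarith
  have e1 : ∀ c : ℝ, c = -b ∨ c = b → ‖∫ x : ℝ in (0 : ℝ)..A, f (x + (c : ℝ) * Complex.I)‖
      ≤ C * A := fun c hc => by
    have := intervalIntegral.norm_integral_le_of_norm_le_const (a := 0) (b := A) (C := C)
      (f := fun x : ℝ => f (x + (c : ℝ) * Complex.I)) fun x hx =>
      h _ (horizontal_mem_rectBoundary (Set.Ioc_subset_Icc_self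
        (by rwa [Set.uIoc_of_le hA] at hx)) hc)
    rwa [sub_zero, abs_of_nonneg hA] at this
  have e2 : ∀ c : ℝ, c = 0 ∨ c = A →
      ‖Complex.I * ∫ y : ℝ in (-b)..b, f ((c : ℝ) + y * Complex.I)‖ ≤ C * (2 * b) := fun c hc => by
    have := intervalIntegral.norm_integral_le_of_norm_le_const (a := -b) (b := b) (C := C)
      (f := fun y : ℝ => f ((c : ℝ) + y * Complex.I)) fun x hx =>
      h _ (vertical_mem_rectBoundary (Set.Ioc_subset_Icc_self
        (by rwa [Set.uIoc_of_le hb'] at hx)) hc)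
    rw [norm_mul, Complex.norm_I, one_mul]
    rwa [show b - -b = 2 * b by ring, abs_of_nonneg (by linarith)] at this
  unfold rectIntegral
  refine (norm_sub_le _ _).trans ?_
  refine (add_le_add (norm_add_le _ _) le_rfl).trans ?_
  refine (add_le_add (add_le_add (norm_sub_le _ _) le_rfl) le_rfl).trans ?_
  linarith [e1 _ (.inl rfl), e1 _ (.inr rfl), e2 _ (.inl rfl), e2 _ (.inr rfl)]

/-- A function with a primitive has vanishing integral along the closed boundary. -/
lemma rectIntegral_eq_zero_of_hasDerivAt (hA : 0 ≤ A) (hb : 0 ≤ b)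
    (hF : ∀ s ∈ rectBoundary A b, HasDerivAt F (f s) s)
    (hf : ContinuousOn f (rectBoundary A b)) : rectIntegral A b f = 0 := by
  have hb' : -b ≤ b := by linarith
  have e1 : ∀ c : ℝ, c = -b ∨ c = b → (∫ x : ℝ in (0 : ℝ)..A, f (x + (c : ℝ) * Complex.I))
      = F ((A : ℝ) + (c : ℝ) * Complex.I) - F ((0 : ℝ) + (c : ℝ) * Complex.I) := fun c hc => by
    refine intervalIntegral.integral_eq_sub_of_hasDerivAt
      (f := fun x : ℝ => F (x + (c : ℝ) * Complex.I)) (fun x hx => ?_)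
      (intervalIntegrable_horizontal hA hf hc)
    rw [Set.uIcc_of_le hA] at hx
    have h1 : HasDerivAt (fun x : ℝ => (x + (c : ℝ) * Complex.I : ℂ)) 1 x :=
      (Complex.ofRealCLM.hasDerivAt (x := x)).add_const _
    exact ((hF _ (horizontal_mem_rectBoundary hx hc)).comp x h1).congr_deriv (mul_one _)
  have e2 : ∀ c : ℝ, c = 0 ∨ c = A →
      Complex.I * (∫ y : ℝ in (-b)..b, f ((c : ℝ) + y * Complex.I))
      = F ((c : ℝ) + (b : ℝ) * Complex.I) - F ((c : ℝ) + (-b : ℝ) * Complex.I) := fun c hc => by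
    rw [← intervalIntegral.integral_const_mul]
    refine intervalIntegral.integral_eq_sub_of_hasDerivAt
      (f := fun y : ℝ => F ((c : ℝ) + y * Complex.I)) (fun x hx => ?_)
      ((intervalIntegrable_vertical hb hf hc).const_mul _)
    rw [Set.uIcc_of_le hb'] at hx
    have h1 : HasDerivAt (fun y : ℝ => ((c : ℝ) + y * Complex.I : ℂ)) Complex.I x := by
      simpa using ((Complex.ofRealCLM.hasDerivAt (x := x)).mul_const Complex.I).const_add (c : ℂ)
    exact ((hF _ (vertical_mem_rectBoundary hx hc)).comp x h1).congr_deriv (mul_comm _ _)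
  rw [rectIntegral, e1 _ (.inl rfl), e1 _ (.inr rfl), e2 _ (.inl rfl), e2 _ (.inr rfl)]
  ring

lemma rectIntegral_eq_zero_of_differentiableOn (hA : 0 ≤ A) (hb : 0 ≤ b)
    (hf : DifferentiableOn ℂ f (Set.Icc 0 A ×ℂ Set.Icc (-b) b)) : rectIntegral A b f = 0 := by
  have h := Complex.integral_boundary_rect_eq_zero_of_differentiableOn f ⟨0, -b⟩ ⟨A, b⟩
    (by simpa [Set.uIcc_of_le hA, Set.uIcc_of_le (show -b ≤ b by linarith)] using hf)
  simpa [rectIntegral] using h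

/-- The winding number of the boundary around an interior point `p` does not vanish: the imaginary
part of each of the four edge integrals of `1 / (s - p)` is positive. -/
lemma rectIntegral_inv_sub_ne_zero {p : ℝ} (hb : 0 < b) (hp : 0 < p) (hpA : p < A) :
    rectIntegral A b (fun s => (s - p)⁻¹) ≠ 0 := by
  have hA : 0 < A := hp.trans hpA
  have hb' : -b < b := by linarith
  have hcont : ContinuousOn (fun s : ℂ => (s - p)⁻¹) (rectBoundary A b) :=
    ContinuousOn.inv₀ (by fun_prop) fun s hs => sub_ne_zero.2 (ne_of_mem_rectBoundary hb hp hpA hs)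
  have pos : ∀ {u v : ℝ} {φ : ℝ → ℂ}, u < v → IntervalIntegrable φ MeasureTheory.volume u v →
      (∀ t ∈ Set.Ioo u v, 0 < (φ t).im) → 0 < (∫ t in u..v, φ t).im := fun {u v φ} huv hφ h => by
    have him : (∫ t in u..v, φ t).im = ∫ t in u..v, (φ t).im :=
      (Complex.imCLM.intervalIntegral_comp_comm hφ).symm
    rw [him]
    exact intervalIntegral.intervalIntegral_pos_of_pos_on ⟨hφ.1.im, hφ.2.im⟩ h huv
  have nsq : ∀ s ∈ rectBoundary A b, 0 < Complex.normSq (s - p) := fun s hs =>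
    Complex.normSq_pos.2 (sub_ne_zero.2 (ne_of_mem_rectBoundary hb hp hpA hs))
  have h1 := pos hA (intervalIntegrable_horizontal hA.le hcont (.inl rfl)) fun t ht => by
    rw [Complex.inv_im]
    refine div_pos ?_ (nsq _ (horizontal_mem_rectBoundary (Set.Ioo_subset_Icc_self ht) (.inl rfl)))
    simpa using hb
  have h2 := pos hA (intervalIntegrable_horizontal hA.le hcont (.inr rfl)).neg fun t ht => by
    rw [Pi.neg_apply, Complex.neg_im, Complex.inv_im, ← neg_div]
    refine div_pos ?_ (nsq _ (horizontal_mem_rectBoundary (Set.Ioo_subset_Icc_self ht) (.inr rfl)))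
    simpa using hb
  have h3 := pos hb' ((intervalIntegrable_vertical hb.le hcont (.inr rfl)).const_mul Complex.I)
    fun t ht => by
      rw [Complex.I_mul_im, Complex.inv_re]
      refine div_pos ?_ (nsq _ (vertical_mem_rectBoundary (Set.Ioo_subset_Icc_self ht) (.inr rfl)))
      simpa using hpA
  have h4 := pos hb' ((intervalIntegrable_vertical hb.le hcont (.inl rfl)).const_mul Complex.I).neg
    fun t ht => by
      rw [Pi.neg_apply, Complex.neg_im, Complex.I_mul_im, Complex.inv_re, ← neg_div]
      refine div_pos ?_ (nsq _ (vertical_mem_rectBoundary (Set.Ioo_subset_Icc_self ht) (.inl rfl)))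
      simpa using hp
  simp only [Pi.neg_apply, intervalIntegral.integral_neg, intervalIntegral.integral_const_mul,
    Complex.neg_im] at h1 h2 h3 h4
  intro h0
  have h5 := congrArg Complex.im h0
  rw [rectIntegral, Complex.sub_im, Complex.add_im, Complex.sub_im, Complex.zero_im] at h5
  linarith

/-! ### Taylor coefficients at `1` as integrals in the logarithmic coordinate -/

lemma exp_mem_slitPlane_of_abs_im_lt {w : ℂ} (hw : |w.im| < π) :
    Complex.exp w ∈ Complex.slitPlane := by
  have h := abs_lt.1 hw
  rw [Complex.mem_slitPlane_iff_arg, Complex.arg_exp, toIocMod_eq_self (hp := Real.two_pi_pos) |>.2]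
  · exact ⟨by linarith, Complex.exp_ne_zero _⟩
  · constructor <;> linarith

lemma exp_ne_one_of_abs_im_lt {w : ℂ} (hw : |w.im| < π) (h0 : w ≠ 0) : Complex.exp w ≠ 1 := by
  intro h
  have h' := abs_lt.1 hw
  exact h0 (by rw [← Complex.log_exp h'.1 h'.2.le, h, Complex.log_one])

/-- The residue theorem for the substitution `y = exp (s - p)`: the pole of order `k + 1` at `s = p`
contributes the `k`-th Taylor coefficient of `g` at `y = 1`. Integration by parts reduces the order
of the pole. -/
lemma rectIntegral_exp_eq {p : ℝ} (hb : 0 < b) (hbπ : b < π) (hp : 0 < p) (hpA : p < A) (k : ℕ) :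
    ∀ g : ℂ → ℂ, DifferentiableOn ℂ g Complex.slitPlane →
    rectIntegral A b (fun s => g (Complex.exp (s - p)) * Complex.exp (s - p)
        / (Complex.exp (s - p) - 1) ^ (k + 1))
      = iteratedDeriv k g 1 / (k.factorial : ℂ) * rectIntegral A b (fun s => (s - p)⁻¹) := by
  have hA : 0 < A := hp.trans hpA
  have hmem : ∀ s ∈ rectBoundary A b, Complex.exp (s - p) ∈ Complex.slitPlane := fun s hs =>
    exp_mem_slitPlane_of_abs_im_lt (by
      simpa using (abs_im_le_of_mem_rectBoundary hb.le hs).trans_lt hbπ)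
  have hne : ∀ s ∈ rectBoundary A b, Complex.exp (s - p) - 1 ≠ 0 := fun s hs =>
    sub_ne_zero.2 (exp_ne_one_of_abs_im_lt (by
      simpa using (abs_im_le_of_mem_rectBoundary hb.le hs).trans_lt hbπ)
      (sub_ne_zero.2 (ne_of_mem_rectBoundary hb hp hpA hs)))
  have hexp : ∀ s : ℂ, HasDerivAt (fun s : ℂ => Complex.exp (s - p)) (Complex.exp (s - p)) s :=
    fun s => by simpa using ((hasDerivAt_id s).sub_const (p : ℂ)).cexp
  have hcont : ∀ (g : ℂ → ℂ) (k : ℕ), DifferentiableOn ℂ g Complex.slitPlane →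
      ContinuousOn (fun s : ℂ => g (Complex.exp (s - p)) * Complex.exp (s - p)
        / (Complex.exp (s - p) - 1) ^ k) (rectBoundary A b) := fun g k hg => by
    refine ContinuousOn.div (ContinuousOn.mul (hg.continuousOn.comp (by fun_prop) hmem)
      (by fun_prop)) (by fun_prop) fun s hs => pow_ne_zero _ (hne s hs)
  induction k with
  | zero =>
    intro g hg
    -- The strip on which `s ↦ exp (s - p)` takes values in the slit plane.
    let S : Set ℂ := {s | |s.im| < π}
    have hS : IsOpen S := isOpen_lt (by fun_prop) continuous_const
    have hpS : S ∈ 𝓝 (p : ℂ) := hS.mem_nhds (by simpa [S] using Real.pi_pos)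
    let q : ℂ → ℂ := dslope (fun s : ℂ => Complex.exp (s - p)) p
    have hq : ∀ s, (s - p) * q s = Complex.exp (s - p) - 1 := fun s => by
      simpa [q] using sub_smul_dslope (fun s : ℂ => Complex.exp (s - p)) (p : ℂ) s
    have hqp : q p = 1 := by
      simp only [q, dslope_same, (hexp p).deriv, sub_self, Complex.exp_zero]
    have hq0 : ∀ s ∈ S, q s ≠ 0 := fun s hs h => by
      have h1 := hq s
      rw [h, mul_zero] at h1
      by_cases hsp : s = p
      · rw [hsp, hqp] at h; exact one_ne_zero h
      · exact exp_ne_one_of_abs_im_lt (by simpa [S] using hs) (sub_ne_zero.2 hsp)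
          (sub_eq_zero.1 h1.symm)
    have hqd : DifferentiableOn ℂ q S := (Complex.differentiableOn_dslope hpS).2
      fun s _ => (hexp s).differentiableAt.differentiableWithinAt
    let m : ℂ → ℂ := fun s => g (Complex.exp (s - p)) * Complex.exp (s - p) / q s
    have hm : DifferentiableOn ℂ m S := by
      refine DifferentiableOn.div (DifferentiableOn.mul (hg.comp ?_ ?_) ?_) hqd hq0
      · fun_prop
      · exact fun s hs => exp_mem_slitPlane_of_abs_im_lt (by simpa [S] using hs)
      · fun_prop
    have hmd : DifferentiableOn ℂ (dslope m p) S := (Complex.differentiableOn_dslope hpS).2 hm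
    have hmp : m p = g 1 := by simp [m, hqp]
    have hsub : Set.Icc 0 A ×ℂ Set.Icc (-b) b ⊆ S := fun s hs =>
      (abs_le.2 (Complex.mem_reProdIm.1 hs).2).trans_lt hbπ
    have hsub' : rectBoundary A b ⊆ S := fun s hs =>
      (abs_im_le_of_mem_rectBoundary hb.le hs).trans_lt hbπ
    have hinv : ContinuousOn (fun s : ℂ => (s - p)⁻¹) (rectBoundary A b) :=
      ContinuousOn.inv₀ (by fun_prop)
        fun s hs => sub_ne_zero.2 (ne_of_mem_rectBoundary hb hp hpA hs)
    have hsplit : Set.EqOn (fun s => g (Complex.exp (s - p)) * Complex.exp (s - p)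
        / (Complex.exp (s - p) - 1) ^ (0 + 1)) (fun s => g 1 * (s - p)⁻¹ + dslope m p s)
        (rectBoundary A b) := fun s hs => by
      have hsp : s - p ≠ 0 := sub_ne_zero.2 (ne_of_mem_rectBoundary hb hp hpA hs)
      have h1 := sub_smul_dslope m (p : ℂ) s
      rw [smul_eq_mul, hmp] at h1
      have h2 : dslope m p s = (m s - g 1) / (s - p) := by rw [← h1]; field_simp
      have h3 := hq0 s (hsub' hs)
      simp only [zero_add, pow_one, ← hq s, h2, m]
      field_simp
      ring
    rw [rectIntegral_congr hA.le hb.le hsplit,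
      rectIntegral_add (f := fun s => g 1 * (s - p)⁻¹) hA.le hb.le (continuousOn_const.mul hinv) (hmd.continuousOn.mono hsub'),
      rectIntegral_const_mul, rectIntegral_eq_zero_of_differentiableOn hA.le hb.le (hmd.mono hsub)]
    simp
  | succ k ih =>
    intro g hg
    have hg' : DifferentiableOn ℂ (deriv g) Complex.slitPlane :=
      hg.deriv Complex.isOpen_slitPlane
    have h1 := ih (deriv g) hg'
    have hk : (k + 1 : ℂ) ≠ 0 := by exact_mod_cast k.succ_ne_zero
    have hkf : (k.factorial : ℂ) ≠ 0 := by exact_mod_cast k.factorial_ne_zero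
    have hprim : rectIntegral A b (fun s =>
        deriv g (Complex.exp (s - p)) * Complex.exp (s - p) / (Complex.exp (s - p) - 1) ^ (k + 1)
        + (-(k + 1 : ℂ)) * (g (Complex.exp (s - p)) * Complex.exp (s - p)
        / (Complex.exp (s - p) - 1) ^ (k + 1 + 1))) = 0 := by
      refine rectIntegral_eq_zero_of_hasDerivAt
        (F := fun s => g (Complex.exp (s - p)) / (Complex.exp (s - p) - 1) ^ (k + 1))
        hA.le hb.le (fun s hs => ?_)
        ((hcont _ _ hg').add (continuousOn_const.mul (hcont _ _ hg)))
      have hgs : HasDerivAt g (deriv g (Complex.exp (s - p))) (Complex.exp (s - p)) :=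
        (hg.differentiableAt (Complex.isOpen_slitPlane.mem_nhds (hmem s hs))).hasDerivAt
      have h0 := hne s hs
      refine ((hgs.comp s (hexp s)).fun_div (((hexp s).sub_const 1).fun_pow (k + 1))
        (pow_ne_zero _ h0)).congr_deriv ?_
      rw [Nat.add_sub_cancel, Function.comp_apply]
      push_cast
      field_simp
      ring
    rw [rectIntegral_add (g := fun s => -(k + 1 : ℂ) * (g (Complex.exp (s - p))
        * Complex.exp (s - p) / (Complex.exp (s - p) - 1) ^ (k + 1 + 1))) hA.le hb.le (hcont _ _ hg') (continuousOn_const.mul (hcont _ _ hg)),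
      rectIntegral_const_mul, h1] at hprim
    rw [iteratedDeriv_succ', Nat.factorial_succ]
    push_cast
    have h2 : (k + 1 : ℂ) * rectIntegral A b (fun s => g (Complex.exp (s - p))
        * Complex.exp (s - p) / (Complex.exp (s - p) - 1) ^ (k + 1 + 1))
        = iteratedDeriv k (deriv g) 1 / (k.factorial : ℂ)
          * rectIntegral A b (fun s => (s - p)⁻¹) := by
      linear_combination -hprim
    field_simp at h2 ⊢
    linear_combination h2

end rect

/-- If `|exp (s - p) - 1| ≥ R |s|` on the boundary of the rectangle, the Lagrange coefficients
grow at most like `R⁻ⁿ`. -/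
lemma exists_norm_lagrangeCoeff_le {A b p R : ℝ} (hb : 0 < b) (hbπ : b < π) (hp : 0 < p)
    (hpA : p < A) (hR : 0 < R)
    (h : ∀ s ∈ rectBoundary A b, R * ‖s‖ ≤ ‖Complex.exp (s - p) - 1‖) :
    ∃ C : ℝ, ∀ n : ℕ, ‖lagrangeCoeff p n‖ ≤ C * (R⁻¹) ^ n := by
  have hA : 0 < A := hp.trans hpA
  set W := rectIntegral A b (fun s => (s - p)⁻¹) with hW
  have hW0 : 0 < ‖W‖ := norm_pos_iff.2 (rectIntegral_inv_sub_ne_zero hb hp hpA)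
  refine ⟨R⁻¹ * Real.exp (A - p) * (2 * A + 4 * b) / ‖W‖, fun n => ?_⟩
  have hd : DifferentiableOn ℂ (fun y : ℂ => (p + Complex.log y) ^ (n + 1)) Complex.slitPlane :=
    fun y hy => (hasDerivAt_add_log_pow p (n + 1) hy).differentiableAt.differentiableWithinAt
  have hmain := rectIntegral_exp_eq hb hbπ hp hpA n _ hd
  rw [← hW] at hmain
  have hbound : ∀ s ∈ rectBoundary A b,
      ‖(p + Complex.log (Complex.exp (s - p))) ^ (n + 1) * Complex.exp (s - p)
        / (Complex.exp (s - p) - 1) ^ (n + 1)‖ ≤ (R⁻¹) ^ (n + 1) * Real.exp (A - p) := by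
    intro s hs
    have him : |s.im| < π := (abs_im_le_of_mem_rectBoundary hb.le hs).trans_lt hbπ
    have hre : s.re ≤ A := by
      rcases hs with ⟨h1, -⟩ | ⟨h1 | h1, -⟩
      · exact h1.2
      · rw [h1]; exact hA.le
      · exact h1.le
    rw [Complex.log_exp (by simpa using (abs_lt.1 him).1) (by simpa using (abs_lt.1 him).2.le),
      add_sub_cancel, norm_div, norm_mul, norm_pow, norm_pow, mul_div_right_comm, ← div_pow]
    have h0 : 0 < ‖Complex.exp (s - p) - 1‖ := norm_pos_iff.2 (sub_ne_zero.2
      (exp_ne_one_of_abs_im_lt (by simpa using him)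
      (sub_ne_zero.2 (ne_of_mem_rectBoundary hb hp hpA hs))))
    refine mul_le_mul ?_ ?_ (norm_nonneg _) (by positivity)
    · refine pow_le_pow_left₀ (by positivity) ?_ _
      rw [div_le_iff₀ h0, inv_mul_eq_div, le_div_iff₀ hR, mul_comm]
      exact h s hs
    · rw [Complex.norm_exp]
      exact Real.exp_le_exp.2 (by simpa using hre)
  have h1 := norm_rectIntegral_le hA.le hb.le hbound
  rw [hmain, norm_mul] at h1
  change ‖lagrangeCoeff p n‖ * _ ≤ _ at h1
  rw [div_mul_eq_mul_div, le_div_iff₀ hW0]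
  refine h1.trans (le_of_eq ?_)
  rw [pow_succ]
  ring

/-! ### The Lagrange inversion formula -/

lemma hasSum_circleIntegral_of_norm_le {c : ℂ} {R : ℝ} (hR : 0 ≤ R) {F : ℕ → ℂ → ℂ} {f : ℂ → ℂ}
    {u : ℕ → ℝ} (hF : ∀ n, ContinuousOn (F n) (Metric.sphere c R))
    (hu : ∀ n, ∀ z ∈ Metric.sphere c R, ‖F n z‖ ≤ u n) (hs : Summable u)
    (hf : ∀ z ∈ Metric.sphere c R, HasSum (fun n => F n z) (f z)) :
    HasSum (fun n => ∮ z in C(c, R), F n z) (∮ z in C(c, R), f z) := by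
  have hmem : ∀ θ, circleMap c R θ ∈ Metric.sphere c R := fun θ => circleMap_mem_sphere c hR θ
  have hd : Continuous (deriv (circleMap c R)) := by
    have : deriv (circleMap c R) = fun θ => circleMap 0 R θ * Complex.I :=
      funext fun θ => deriv_circleMap c R θ
    rw [this]; fun_prop
  refine intervalIntegral.hasSum_integral_of_dominated_convergence (fun n _ => |R| * u n)
    (fun n => ?_) (fun n => ?_) ?_ ?_ ?_
  · exact (hd.smul ((hF n).comp_continuous (continuous_circleMap c R) hmem)).aestronglyMeasurable
  · refine Eventually.of_forall fun θ _ => ?_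
    rw [norm_smul]
    refine mul_le_mul ?_ (hu n _ (hmem θ)) (norm_nonneg _) (abs_nonneg _)
    simp [deriv_circleMap]
  · exact Eventually.of_forall fun θ _ => hs.mul_left _
  · exact intervalIntegrable_const
  · exact Eventually.of_forall fun θ _ => (hf _ (hmem θ)).const_smul _

lemma closedBall_one_half_subset : Metric.closedBall (1 : ℂ) (1 / 2) ⊆ Metric.ball 1 1 :=
  Metric.closedBall_subset_ball (by norm_num)

lemma ball_one_subset_slitPlane : Metric.ball (1 : ℂ) 1 ⊆ Complex.slitPlane := fun y hy => by
  have := Complex.mem_slitPlane_of_norm_lt_one (z := y - 1) (by simpa [dist_eq_norm] using hy)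
  simpa using this

lemma norm_inv_le_two {y : ℂ} (hy : y ∈ Metric.closedBall (1 : ℂ) (1 / 2)) : ‖y⁻¹‖ ≤ 2 := by
  rw [Metric.mem_closedBall, dist_eq_norm] at hy
  have h := norm_sub_norm_le (1 : ℂ) (1 - y)
  rw [sub_sub_cancel, norm_one, norm_sub_rev] at h
  rw [norm_inv, inv_le_comm₀ (by linarith) (by norm_num)]
  linarith

/-- The difference quotients of `p + log` on the disc `|y - 1| ≤ 1/2` are bounded by `2`. -/
lemma norm_dslope_add_log_le (p : ℂ) {w y : ℂ} (hw : w ∈ Metric.closedBall (1 : ℂ) (1 / 2))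
    (hy : y ∈ Metric.closedBall (1 : ℂ) (1 / 2)) :
    ‖dslope (fun y : ℂ => p + Complex.log y) w y‖ ≤ 2 := by
  have hd : ∀ y ∈ Metric.closedBall (1 : ℂ) (1 / 2),
      HasDerivAt (fun y : ℂ => p + Complex.log y) y⁻¹ y := fun y hy =>
    (Complex.hasDerivAt_log
      (ball_one_subset_slitPlane (closedBall_one_half_subset hy))).const_add p
  by_cases h : y = w
  · rw [h, dslope_same, (hd w hw).deriv]
    exact norm_inv_le_two hw
  · rw [dslope_of_ne _ h, slope_def_field, norm_div,
      div_le_iff₀ (norm_pos_iff.2 (sub_ne_zero.2 h))]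
    exact Convex.norm_image_sub_le_of_norm_hasDerivWithin_le
      (fun x hx => (hd x hx).hasDerivWithinAt) (fun x hx => norm_inv_le_two hx)
      (convex_closedBall _ _) hw hy

/-- Lagrange inversion near `ε = 0`: at the solution `w` of `w = 1 + ε (p + log w)`, the series
`∑ aₙ εⁿ` sums to the derivative `dw/dε`. The sum is a geometric series under Cauchy's integral for
the coefficients; the resulting integrand has `w` as its only pole. -/
lemma exists_hasSum_lagrangeCoeff (p : ℂ) : ∃ r > 0, ∀ ε w : ℂ, ‖ε‖ < r →
    w ∈ Metric.ball (1 : ℂ) (1 / 2) → w - 1 = ε * (p + Complex.log w) →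
    HasSum (fun n => lagrangeCoeff p n * ε ^ n) ((p + Complex.log w) / (1 - ε / w)) := by
  have hφd : ∀ y ∈ Metric.ball (1 : ℂ) 1,
      HasDerivAt (fun y : ℂ => p + Complex.log y) y⁻¹ y := fun y hy =>
    (Complex.hasDerivAt_log (ball_one_subset_slitPlane hy)).const_add p
  have hφ : DifferentiableOn ℂ (fun y : ℂ => p + Complex.log y) (Metric.ball 1 1) := fun y hy =>
    (hφd y hy).differentiableAt.differentiableWithinAt
  have hsub : Metric.sphere (1 : ℂ) (1 / 2) ⊆ Metric.closedBall 1 (1 / 2) :=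
    Metric.sphere_subset_closedBall
  obtain ⟨B, hB⟩ := (isCompact_sphere (1 : ℂ) (1 / 2)).exists_bound_of_continuousOn
    (hφ.continuousOn.mono (hsub.trans closedBall_one_half_subset))
  have hB1 : 0 < |B| + 1 := by positivity
  refine ⟨min (1 / 4) (1 / (4 * (|B| + 1))), by positivity, fun ε w hε hw hεw => ?_⟩
  have hε1 : ‖ε‖ < 1 / 4 := hε.trans_le (min_le_left _ _)
  have hε2 : ‖ε‖ * (|B| + 1) ≤ 1 / 4 := by
    have := hε.le.trans (min_le_right _ _)
    rw [le_div_iff₀ (by positivity)] at this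
    linarith
  have hwc : w ∈ Metric.closedBall (1 : ℂ) (1 / 2) := Metric.ball_subset_closedBall hw
  have hw1 : w ∈ Metric.ball (1 : ℂ) 1 := closedBall_one_half_subset hwc
  set φ : ℂ → ℂ := fun y => p + Complex.log y with hφdef
  let k : ℂ → ℂ := fun y => 1 - ε * dslope φ w y
  have hk : DifferentiableOn ℂ k (Metric.closedBall 1 (1 / 2)) := by
    have : DifferentiableOn ℂ (dslope φ w) (Metric.ball 1 1) :=
      (Complex.differentiableOn_dslope (Metric.isOpen_ball.mem_nhds hw1)).2 hφ
    exact ((this.mono closedBall_one_half_subset).const_mul ε).const_sub 1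
  have hk0 : ∀ y ∈ Metric.closedBall (1 : ℂ) (1 / 2), k y ≠ 0 := fun y hy h => by
    have h1 : ‖ε * dslope φ w y‖ ≤ 1 / 4 * 2 := by
      rw [norm_mul]
      exact mul_le_mul hε1.le (norm_dslope_add_log_le p hwc hy) (norm_nonneg _) (by norm_num)
    rw [← sub_eq_zero.1 h, norm_one] at h1
    norm_num at h1
  have hkw : k w = 1 - ε / w := by
    simp only [k, dslope_same, (hφd w hw1).deriv, div_eq_mul_inv]
  have hfac : ∀ y, (y - w) * k y = y - 1 - ε * φ y := fun y => by
    have h1 := sub_smul_dslope φ w y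
    rw [smul_eq_mul] at h1
    simp only [k]
    linear_combination (-ε) * h1 - hεw
  have hcauchy := DifferentiableOn.circleIntegral_sub_inv_smul
    (f := fun y => φ y / k y) ((hφ.mono closedBall_one_half_subset).div hk hk0) hw
  have hcoeff : ∀ n : ℕ, (∮ y in C(1, 1 / 2), ε ^ n * ((1 / (y - 1) ^ (n + 1)) • φ y ^ (n + 1)))
      = 2 * π * Complex.I * (lagrangeCoeff p n * ε ^ n) := fun n => by
    rw [circleIntegral.integral_const_mul,
      DifferentiableOn.circleIntegral_one_div_sub_center_pow_smul (by norm_num) n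
        ((hφ.mono closedBall_one_half_subset).fun_pow (n + 1)), lagrangeCoeff, smul_eq_mul]
    ring
  have hdist : ∀ y ∈ Metric.sphere (1 : ℂ) (1 / 2), ‖y - 1‖ = 1 / 2 := fun y hy => by
    rwa [mem_sphere_iff_norm] at hy
  have hy1 : ∀ y ∈ Metric.sphere (1 : ℂ) (1 / 2), y - 1 ≠ 0 := fun y hy h => by
    have := hdist y hy
    rw [h, norm_zero] at this
    norm_num at this
  have hbd : ∀ y ∈ Metric.sphere (1 : ℂ) (1 / 2), ‖φ y‖ ≤ |B| + 1 := fun y hy =>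
    (hB y hy).trans ((le_abs_self B).trans (by linarith))
  have hq : ∀ y ∈ Metric.sphere (1 : ℂ) (1 / 2), ‖ε * φ y / (y - 1)‖ ≤ 1 / 2 := fun y hy => by
    rw [norm_div, norm_mul, hdist y hy, div_le_iff₀ (by norm_num)]
    nlinarith [mul_le_mul_of_nonneg_left (hbd y hy) (norm_nonneg ε)]
  have hterm : ∀ (n : ℕ), ∀ y ∈ Metric.sphere (1 : ℂ) (1 / 2),
      ε ^ n * ((1 / (y - 1) ^ (n + 1)) • φ y ^ (n + 1))
        = φ y / (y - 1) * (ε * φ y / (y - 1)) ^ n := fun n y hy => by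
    have := hy1 y hy
    rw [smul_eq_mul, div_pow, mul_pow, pow_succ, pow_succ]
    field_simp
  have hsum : HasSum (fun n : ℕ => ∮ y in C(1, 1 / 2),
      ε ^ n * ((1 / (y - 1) ^ (n + 1)) • φ y ^ (n + 1)))
      (∮ y in C(1, 1 / 2), (y - w)⁻¹ • (φ y / k y)) := by
    refine hasSum_circleIntegral_of_norm_le (by norm_num)
      (u := fun n => 2 * (|B| + 1) * (1 / 2) ^ n) (fun n => ?_) (fun n y hy => ?_) ?_
      fun y hy => ?_
    · refine continuousOn_const.mul (ContinuousOn.smul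
        (continuousOn_const.div (by fun_prop) fun y hy => pow_ne_zero _ (hy1 y hy)) ?_)
      exact (hφ.continuousOn.mono (hsub.trans closedBall_one_half_subset)).pow _
    · rw [hterm n y hy, norm_mul, norm_pow]
      refine mul_le_mul ?_ (pow_le_pow_left₀ (norm_nonneg _) (hq y hy) n) (by positivity)
        (by positivity)
      rw [norm_div, hdist y hy]
      linarith [hbd y hy]
    · exact (summable_geometric_of_lt_one (by norm_num) (by norm_num)).mul_left _
    · have h0 := hy1 y hy
      have hg := (hasSum_geometric_of_norm_lt_one ((hq y hy).trans_lt (by norm_num))).mul_left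
        (φ y / (y - 1))
      have hyw : y - w ≠ 0 := fun h => by
        have h1 := hdist y hy
        rw [sub_eq_zero.1 h, ← dist_eq_norm] at h1
        exact absurd h1 (ne_of_lt hw)
      have hky := hk0 y (hsub hy)
      have hne : y - 1 - ε * φ y ≠ 0 := by rw [← hfac]; exact mul_ne_zero hyw hky
      have e1 : φ y / (y - 1) * (1 - ε * φ y / (y - 1))⁻¹ = (y - w)⁻¹ • (φ y / k y) := by
        rw [smul_eq_mul, inv_mul_eq_div, div_div, mul_comm (k y), hfac, one_sub_div h0,
          inv_div, div_mul_div_cancel₀ h0]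
      rw [← e1]
      exact hg.congr_fun fun n => hterm n y hy
  rw [hcauchy] at hsum
  simp only [hcoeff, hkw] at hsum
  rw [smul_eq_mul] at hsum
  exact (hasSum_mul_left_iff Complex.two_pi_I_ne_zero).1 hsum

lemma hasDerivAt_exp_sub_one_div (p : ℂ) {s : ℂ} (hs : s ≠ 0) :
    HasDerivAt (fun s : ℂ => (Complex.exp (s - p) - 1) / s)
      ((s * Complex.exp (s - p) - (Complex.exp (s - p) - 1)) / s ^ 2) s := by
  have hexp : HasDerivAt (fun s : ℂ => Complex.exp (s - p)) (Complex.exp (s - p)) s := by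
    simpa using ((hasDerivAt_id s).sub_const p).cexp
  refine ((hexp.sub_const 1).fun_div (hasDerivAt_id s) hs).congr_deriv ?_
  simp [mul_comm]

/-- Lagrange inversion in the logarithmic coordinate `s`, where `ε = (exp (s - p) - 1) / s`: the
relation `(dw/dε) (dε/ds) = dw/ds` for `w = exp (s - p)`. -/
lemma eventually_lagrange_eq {p : ℂ} (hp : p ≠ 0) {K : ℂ → ℂ} {ρ : ℝ} (hρ : 0 < ρ)
    (hK : ∀ ε : ℂ, ‖ε‖ < ρ → HasSum (fun n => lagrangeCoeff p n * ε ^ n) (K ε)) :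
    ∀ᶠ s in 𝓝 p, K ((Complex.exp (s - p) - 1) / s) *
      ((s * Complex.exp (s - p) - (Complex.exp (s - p) - 1)) / s ^ 2) = Complex.exp (s - p) := by
  obtain ⟨r, hr, h⟩ := exists_hasSum_lagrangeCoeff p
  have hE : ContinuousAt (fun s : ℂ => (Complex.exp (s - p) - 1) / s) p :=
    (hasDerivAt_exp_sub_one_div p hp).continuousAt
  have hexp : ContinuousAt (fun s : ℂ => Complex.exp (s - p)) p := by fun_prop
  have him : ContinuousAt (fun s : ℂ => |(s - p).im|) p := by fun_prop
  have h1 : ∀ᶠ s in 𝓝 p, (Complex.exp (s - p) - 1) / s ∈ Metric.ball (0 : ℂ) (min r ρ) :=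
    hE.eventually_mem (Metric.isOpen_ball.mem_nhds (by simp [hr, hρ]))
  have h2 : ∀ᶠ s in 𝓝 p, Complex.exp (s - p) ∈ Metric.ball (1 : ℂ) (1 / 2) :=
    hexp.eventually_mem (Metric.isOpen_ball.mem_nhds (by simp))
  have h3 : ∀ᶠ s in 𝓝 p, |(s - p).im| < π :=
    him.eventually_lt continuousAt_const (by simpa using Real.pi_pos)
  have h4 : ∀ᶠ s in 𝓝 p, s * Complex.exp (s - p) - (Complex.exp (s - p) - 1) ≠ 0 := by
    refine ContinuousAt.eventually_ne (by fun_prop) ?_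
    simpa using hp
  filter_upwards [h1, h2, h3, h4, eventually_ne_nhds hp] with s hs1 hs2 hs3 hs4 hs0
  rw [mem_ball_zero_iff, lt_min_iff] at hs1
  have hlog : p + Complex.log (Complex.exp (s - p)) = s := by
    rw [Complex.log_exp (abs_lt.1 hs3).1 (abs_lt.1 hs3).2.le, add_sub_cancel]
  have hsum := h _ _ hs1.1 hs2 (by rw [hlog, div_mul_cancel₀ _ hs0])
  rw [(hK _ hs1.2).unique hsum, hlog]
  have hw0 := Complex.exp_ne_zero (s - p)
  set w := Complex.exp (s - p)
  set ε := (w - 1) / s with hε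
  have hd : (s * w - (w - 1)) / s ^ 2 = (w - ε) / s := by
    rw [hε]; field_simp
  have hwε : w - ε ≠ 0 := fun hw => hs4 ((div_eq_zero_iff.1
    (hd.trans (by rw [hw, zero_div]))).resolve_right (pow_ne_zero 2 hs0))
  rw [hd]
  field_simp

/-- Let the connected set `U` contain `p` and a critical point `s₀` of
`ε(s) = (exp (s - p) - 1) / s`, with `|ε| < σ` on `U`. Then `∑ aₙ εⁿ` cannot converge on the disc `|ε| < σ`: the relation
`(∑ aₙ ε(s)ⁿ) ε'(s) = exp (s - p)` would extend along `U` up to `s₀`, where its left side is zero. -/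
lemma false_of_critical_point {p : ℂ} {σ M : ℝ} (hp : p ≠ 0) (hσ : 0 < σ)
    (hM : ∀ n : ℕ, ‖lagrangeCoeff p n‖ * σ ^ n ≤ M * (n + 1)) {U : Set ℂ}
    (hU : IsPreconnected U) {s₀ : ℂ} (hpU : p ∈ U) (hs₀ : s₀ ∈ U)
    (h : ∀ s ∈ U, s ≠ 0 ∧ ‖(Complex.exp (s - p) - 1) / s‖ < σ)
    (hcrit : s₀ * Complex.exp (s₀ - p) = Complex.exp (s₀ - p) - 1) : False := by
  set P := FormalMultilinearSeries.ofScalars ℂ (lagrangeCoeff p)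
  have hrad : ENNReal.ofReal σ ≤ P.radius := by
    refine ENNReal.le_of_forall_nnreal_lt fun r hr => ?_
    have hr' : (r : ℝ) < σ := by
      rwa [← ENNReal.ofReal_coe_nnreal, ENNReal.ofReal_lt_ofReal_iff hσ] at hr
    refine P.le_radius_of_tendsto (l := 0) ?_
    have hq1 : (r : ℝ) / σ < 1 := (div_lt_one hσ).2 hr'
    have hq0 : 0 ≤ (r : ℝ) / σ := by positivity
    have hlim : Tendsto (fun n : ℕ => M * ((n : ℝ) * (r / σ) ^ n + (r / σ) ^ n)) atTop (𝓝 0) := by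
      simpa using ((tendsto_self_mul_const_pow_of_lt_one hq0 hq1).add
        (tendsto_pow_atTop_nhds_zero_of_lt_one hq0 hq1)).const_mul M
    refine squeeze_zero (fun n => by positivity) (fun n => ?_) hlim
    rw [FormalMultilinearSeries.ofScalars_norm]
    have := mul_le_mul_of_nonneg_right (hM n) (pow_nonneg hq0 n)
    rw [mul_assoc, ← mul_pow, mul_div_cancel₀ _ hσ.ne'] at this
    linarith
  have hrad0 : 0 < P.radius := (ENNReal.ofReal_pos.2 hσ).trans_le hrad
  have hball := P.hasFPowerSeriesOnBall hrad0
  have hmem : ∀ ε : ℂ, ‖ε‖ < σ → ε ∈ Metric.eball (0 : ℂ) P.radius := fun ε hε => by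
    refine Metric.eball_subset_eball hrad ?_
    rw [Metric.mem_eball, edist_zero_right, ← ofReal_norm]
    exact (ENNReal.ofReal_lt_ofReal_iff hσ).2 hε
  have hK : ∀ ε : ℂ, ‖ε‖ < σ → HasSum (fun n => lagrangeCoeff p n * ε ^ n) (P.sum ε) :=
    fun ε hε => by
      have := hball.hasSum (hmem ε hε)
      simpa [P, FormalMultilinearSeries.ofScalars_apply_eq, mul_comm] using this
  have hEan : ∀ s : ℂ, s ≠ 0 → AnalyticAt ℂ (fun s : ℂ => (Complex.exp (s - p) - 1) / s) s :=
    fun s hs => by fun_prop (disch := assumption)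
  have hE'an : ∀ s : ℂ, s ≠ 0 → AnalyticAt ℂ
      (fun s : ℂ => (s * Complex.exp (s - p) - (Complex.exp (s - p) - 1)) / s ^ 2) s :=
    fun s hs => by fun_prop (disch := exact pow_ne_zero 2 hs)
  have heq := AnalyticOnNhd.eqOn_of_preconnected_of_eventuallyEq (𝕜 := ℂ) (U := U)
    (f := fun s => P.sum ((Complex.exp (s - p) - 1) / s) *
      ((s * Complex.exp (s - p) - (Complex.exp (s - p) - 1)) / s ^ 2))
    (g := fun s => Complex.exp (s - p))
    (fun s hs => (AnalyticAt.comp (g := P.sum) (f := fun s => (Complex.exp (s - p) - 1) / s)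
      (hball.analyticAt_of_mem (hmem _ (h s hs).2)) (hEan s (h s hs).1)).mul (hE'an s (h s hs).1)) (fun s _ => by fun_prop) hU hpU
    (eventually_lagrange_eq hp hσ hK) hs₀
  simp only [hcrit, sub_self, zero_div, mul_zero] at heq
  exact Complex.exp_ne_zero _ heq.symm

/-! ### The functions `b cot b` and `b / sin b` on `(0, π)` -/

lemma mul_sin_le_mul_sin {y b : ℝ} (hy : 0 ≤ y) (hyb : y ≤ b) (hb : 0 < b) (hbπ : b ≤ π) :
    y * sin b ≤ b * sin y := by
  have h := strictConcaveOn_sin_Icc.concaveOn.2 (show b ∈ Set.Icc 0 π from ⟨hb.le, hbπ⟩)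
    (show (0 : ℝ) ∈ Set.Icc 0 π from ⟨le_rfl, Real.pi_pos.le⟩) (show 0 ≤ y / b by positivity)
    (sub_nonneg.2 ((div_le_one hb).2 hyb)) (by ring)
  simp only [smul_eq_mul, sin_zero, mul_zero, add_zero, div_mul_cancel₀ _ hb.ne'] at h
  rw [div_mul_eq_mul_div, div_le_iff₀ hb] at h
  linarith

lemma mul_cot_lt_one {b : ℝ} (hb : 0 < b) (hbπ : b < π) : b * cot b < 1 := by
  have hs := sin_pos_of_pos_of_lt_pi hb hbπ
  rw [cot_eq_cos_div_sin, ← mul_div_assoc, div_lt_one hs]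
  rcases lt_or_ge b (π / 2) with h | h
  · have h1 := lt_tan hb h
    have hc := cos_pos_of_mem_Ioo ⟨by linarith, h⟩
    rwa [tan_eq_sin_div_cos, lt_div_iff₀ hc] at h1
  · have hc := cos_nonpos_of_pi_div_two_le_of_le h (by linarith)
    nlinarith

lemma strictAntiOn_mul_cot : StrictAntiOn (fun b : ℝ => b * cot b) (Set.Ioo 0 π) := by
  have hd : ∀ b ∈ Set.Ioo (0 : ℝ) π, HasDerivAt (fun b : ℝ => b * cot b)
      ((sin b * cos b - b) / sin b ^ 2) b := fun b hb => by
    have hs := (sin_pos_of_pos_of_lt_pi hb.1 hb.2).ne'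
    have h1 := (hasDerivAt_id b).fun_mul ((hasDerivAt_cos b).fun_div (hasDerivAt_sin b) hs)
    simp only [cot_eq_cos_div_sin]
    refine h1.congr_deriv ?_
    have := sin_sq_add_cos_sq b
    simp only [id]
    field_simp
    linear_combination (-b) * this
  refine strictAntiOn_of_deriv_neg (convex_Ioo 0 π)
    (fun b hb => (hd b hb).continuousAt.continuousWithinAt) fun b hb => ?_
  rw [interior_Ioo] at hb
  rw [(hd b hb).deriv]
  refine div_neg_of_neg_of_pos ?_ (pow_pos (sin_pos_of_pos_of_lt_pi hb.1 hb.2) 2)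
  have h1 := sin_lt (show 0 < 2 * b by linarith [hb.1])
  rw [sin_two_mul] at h1
  linarith

/-- The value of `p = log L` for which `v = b cot b ± b i` solves `v exp (1 - v) = L`. As `b` runs
through `(0, π)`, these are the non-real solutions closest to the real axis for all `L > 1`. -/
noncomputable def logLogOfAngle (b : ℝ) : ℝ := 1 - b * cot b - log (sin b / b)

lemma monotoneOn_logLogOfAngle : MonotoneOn logLogOfAngle (Set.Ioo 0 π) := fun y hy b hb hyb => by
  have h1 := strictAntiOn_mul_cot.antitoneOn hy hb hyb
  have h2 : log (sin b / b) ≤ log (sin y / y) := by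
    refine log_le_log (div_pos (sin_pos_of_pos_of_lt_pi hb.1 hb.2) hb.1) ?_
    rw [div_le_div_iff₀ hb.1 hy.1, mul_comm, mul_comm (sin y)]
    exact mul_sin_le_mul_sin hy.1.le hyb hb.1 hb.2.le
  unfold logLogOfAngle
  linarith

lemma sinc_pos_of_mem {b : ℝ} (hb : b ∈ Set.Ico 0 π) : 0 < sinc b := by
  rcases hb.1.eq_or_lt with h | h
  · simp [← h]
  · rw [sinc_of_ne_zero h.ne']
    exact div_pos (sin_pos_of_pos_of_lt_pi h hb.2) h

lemma mul_cot_eq_cos_div_sinc {b : ℝ} (hb : b ≠ 0) : b * cot b = cos b / sinc b := by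
  rw [sinc_of_ne_zero hb, cot_eq_cos_div_sin, div_div_eq_mul_div]
  ring

lemma cot_pi_div_two_add_arctan (M : ℝ) : cot (π / 2 + arctan M) = -M := by
  rw [cot_eq_cos_div_sin, add_comm, cos_add_pi_div_two, sin_add_pi_div_two, neg_div,
    ← tan_eq_sin_div_cos, tan_arctan]

/-- The point `π/2 + arctan M` with cotangent `-M` bounds the intervals on which the intermediate
value theorem is applied. -/
lemma pi_div_two_add_arctan_mem {M : ℝ} (hM : 0 ≤ M) :
    1 ≤ π / 2 + arctan M ∧ π / 2 + arctan M < π := by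
  have h1 := arctan_nonneg.2 hM
  have h2 := arctan_lt_pi_div_two M
  constructor <;> linarith [pi_gt_three]

lemma existsUnique_isEtaRoot {α : ℝ} (hα : 1 < α) : ∃! η₀ : ℝ, IsEtaRoot α η₀ := by
  have hl := log_pos hα
  obtain ⟨hc1, hcπ⟩ := pi_div_two_add_arctan_mem hl.le
  have hcot := cot_pi_div_two_add_arctan (log α)
  set c := π / 2 + arctan (log α)
  have hcont : ContinuousOn (fun b => cos b / sinc b) (Set.Icc 0 c) :=
    ContinuousOn.div (by fun_prop) continuous_sinc.continuousOn
      fun b hb => (sinc_pos_of_mem ⟨hb.1, hb.2.trans_lt hcπ⟩).ne'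
  have hmem : 1 - log α ∈ Set.Icc (cos c / sinc c) (cos 0 / sinc 0) := by
    rw [← mul_cot_eq_cos_div_sinc (by linarith : c ≠ 0), hcot]
    simp only [cos_zero, sinc_zero, div_one]
    constructor <;> nlinarith
  obtain ⟨η, hη, h⟩ := intermediate_value_Icc' (by linarith : (0 : ℝ) ≤ c) hcont hmem
  have hη0 : 0 < η := hη.1.lt_of_ne fun h0 => by
    simp only [← h0, cos_zero, sinc_zero, div_one] at h
    linarith
  refine ⟨η, ⟨hη0, hη.2.trans_lt hcπ, (mul_cot_eq_cos_div_sinc hη0.ne').trans h⟩, ?_⟩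
  rintro ξ ⟨h1, h2, h3⟩
  refine strictAntiOn_mul_cot.injOn ⟨h1, h2⟩ ⟨hη0, hη.2.trans_lt hcπ⟩ ?_
  exact h3.trans ((mul_cot_eq_cos_div_sinc hη0.ne').trans h).symm

lemma exists_logLogOfAngle_eq {p : ℝ} (hp : 0 < p) : ∃ b ∈ Set.Ioo 0 π, logLogOfAngle b = p := by
  obtain ⟨hc1, hcπ⟩ := pi_div_two_add_arctan_mem hp.le
  have hcot := cot_pi_div_two_add_arctan p
  set c := π / 2 + arctan p
  have hs : ∀ b ∈ Set.Icc 0 c, sinc b ≠ 0 := fun b hb =>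
    (sinc_pos_of_mem ⟨hb.1, hb.2.trans_lt hcπ⟩).ne'
  have hcont : ContinuousOn (fun b => 1 - cos b / sinc b - log (sinc b)) (Set.Icc 0 c) :=
    ((continuousOn_const.sub (ContinuousOn.div (by fun_prop) continuous_sinc.continuousOn hs))).sub
      (continuous_sinc.continuousOn.log hs)
  have hmem : p ∈ Set.Icc (1 - cos 0 / sinc 0 - log (sinc 0))
      (1 - cos c / sinc c - log (sinc c)) := by
    rw [← mul_cot_eq_cos_div_sinc (by linarith : c ≠ 0), hcot]
    have := log_nonpos (sinc_pos_of_mem ⟨by linarith, hcπ⟩).le (sinc_le_one c)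
    simp only [cos_zero, sinc_zero, div_one, log_one]
    constructor <;> nlinarith
  obtain ⟨b, hb, h⟩ := intermediate_value_Icc (by linarith : (0 : ℝ) ≤ c) hcont hmem
  have hb0 : 0 < b := hb.1.lt_of_ne fun h0 => by
    simp [← h0] at h
    linarith
  refine ⟨b, ⟨hb0, hb.2.trans_lt hcπ⟩, ?_⟩
  rw [logLogOfAngle, mul_cot_eq_cos_div_sinc hb0.ne', ← sinc_of_ne_zero hb0.ne']
  exact h

lemma exists_log_add_one_sub_eq {p : ℝ} (hp : p < 0) : ∃ v, 1 < v ∧ log v + 1 - v = p := by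
  have hcont : ContinuousOn (fun v => log v + 1 - v) (Set.Icc 1 (2 - 2 * p)) :=
    ((continuousOn_id.log fun v hv => by
      have := hv.1
      simp only [id]
      linarith).add continuousOn_const).sub continuousOn_id
  have hmem : p ∈ Set.Icc (log (2 - 2 * p) + 1 - (2 - 2 * p)) (log 1 + 1 - 1) := by
    -- The right end is `2 (1 - p)`, whose logarithm is at most `(2 - 1) + ((1 - p) - 1)`.
    have h1 := log_le_sub_one_of_pos (show (0 : ℝ) < 1 - p by linarith)
    have h2 := log_le_sub_one_of_pos (show (0 : ℝ) < 2 by norm_num)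
    have h3 : log (2 - 2 * p) = log 2 + log (1 - p) := by
      rw [← log_mul (by norm_num) (by linarith)]
      ring_nf
    rw [h3, log_one]
    constructor <;> linarith
  obtain ⟨v, hv, h⟩ := intermediate_value_Icc' (by linarith) hcont hmem
  refine ⟨v, hv.1.lt_of_ne fun h1 => ?_, h⟩
  simp only [← h1, log_one] at h
  linarith

/-! ### Estimates of `exp (s - p) - 1` against `s` -/

lemma norm_exp_sub_one_sq (w : ℂ) :
    ‖Complex.exp w - 1‖ ^ 2 = (Real.exp w.re - cos w.im) ^ 2 + sin w.im ^ 2 := by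
  rw [← Complex.normSq_eq_norm_sq, Complex.normSq_apply, Complex.sub_re, Complex.sub_im,
    Complex.exp_re, Complex.exp_im, Complex.one_re, Complex.one_im]
  linear_combination (Real.exp w.re ^ 2 - 1) * sin_sq_add_cos_sq w.im

lemma norm_sq_eq_re_sq_add_im_sq (s : ℂ) : ‖s‖ ^ 2 = s.re ^ 2 + s.im ^ 2 := by
  rw [← Complex.normSq_eq_norm_sq, Complex.normSq_apply]
  ring

section angle

variable {b : ℝ}

lemma exp_sub_logLogOfAngle (hb : 0 < b) (hbπ : b < π) (a : ℝ) :
    Real.exp (a - logLogOfAngle b) = sin b / b * Real.exp (a - 1 + b * cot b) := by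
  have hR : 0 < sin b / b := div_pos (sin_pos_of_pos_of_lt_pi hb hbπ) hb
  rw [show a - logLogOfAngle b = log (sin b / b) + (a - 1 + b * cot b) by unfold logLogOfAngle; ring,
    Real.exp_add, Real.exp_log hR]

lemma sin_div_mul_mul_cot (hb : 0 < b) (hbπ : b < π) : sin b / b * (b * cot b) = cos b := by
  have hs := (sin_pos_of_pos_of_lt_pi hb hbπ).ne'
  rw [cot_eq_cos_div_sin]
  field_simp

/-- On the horizontal edges the estimate is `exp t ≥ 1 + t`, with equality at the critical point. -/
lemma le_norm_exp_sub_one_of_horizontal (hb : 0 < b) (hbπ : b < π) {s : ℂ} (hre : 0 ≤ s.re)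
    (him : s.im = -b ∨ s.im = b) :
    sin b / b * ‖s‖ ≤ ‖Complex.exp (s - logLogOfAngle b) - 1‖ := by
  have hR : 0 < sin b / b := div_pos (sin_pos_of_pos_of_lt_pi hb hbπ) hb
  have hRb : sin b / b * b = sin b := div_mul_cancel₀ _ hb.ne'
  refine le_of_sq_le_sq ?_ (norm_nonneg _)
  rw [mul_pow, norm_exp_sub_one_sq, norm_sq_eq_re_sq_add_im_sq]
  have hκ := exp_sub_logLogOfAngle hb hbπ s.re
  have hre' : (s - logLogOfAngle b).re = s.re - logLogOfAngle b := by simp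
  have him' : (s - logLogOfAngle b).im = s.im := by simp
  have hc : cos s.im = cos b := by rcases him with h | h <;> simp [h]
  have hs : sin s.im ^ 2 = sin b ^ 2 := by rcases him with h | h <;> simp [h]
  have hi : s.im ^ 2 = b ^ 2 := by rcases him with h | h <;> simp [h]
  rw [hre', him', hc, hs, hi, hκ]
  have h1 := mul_le_mul_of_nonneg_left (add_one_le_exp (s.re - 1 + b * cot b)) hR.le
  have h2 := sin_div_mul_mul_cot hb hbπ
  have h3 : sin b / b * s.re ≤ sin b / b * Real.exp (s.re - 1 + b * cot b) - cos b := by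
    linarith
  have h4 := pow_le_pow_left₀ (mul_nonneg hR.le hre) h3 2
  have h5 : (sin b / b) ^ 2 * b ^ 2 = sin b ^ 2 := by rw [← mul_pow, hRb]
  linarith [mul_pow (sin b / b) s.re 2]

lemma le_norm_exp_sub_one_of_re_eq_zero (hb : 0 < b) (hbπ : b < π) (p : ℝ) {s : ℂ}
    (hre : s.re = 0) (him : |s.im| ≤ b) :
    sin b / b * ‖s‖ ≤ ‖Complex.exp (s - p) - 1‖ := by
  have h1 := mul_sin_le_mul_sin (abs_nonneg s.im) him hb hbπ.le
  have h2 : sin b / b * |s.im| ≤ sin |s.im| := by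
    rw [div_mul_eq_mul_div, div_le_iff₀ hb]
    linarith
  have hR : 0 < sin b / b := div_pos (sin_pos_of_pos_of_lt_pi hb hbπ) hb
  have h3 := pow_le_pow_left₀ (by positivity) h2 2
  have h4 : sin |s.im| ^ 2 = sin s.im ^ 2 := by
    rcases abs_choice s.im with h | h <;> simp [h]
  rw [h4, mul_pow, sq_abs] at h3
  refine le_of_sq_le_sq ?_ (norm_nonneg _)
  have him' : (s - p).im = s.im := by simp
  rw [mul_pow, norm_exp_sub_one_sq, norm_sq_eq_re_sq_add_im_sq, him', hre]
  nlinarith [sq_nonneg (Real.exp (s - p).re - cos s.im)]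

lemma exists_le_norm_exp_sub_one (hb : 0 < b) (hbπ : b < π) :
    ∃ A, logLogOfAngle b < A ∧ ∀ s ∈ rectBoundary A b,
      sin b / b * ‖s‖ ≤ ‖Complex.exp (s - logLogOfAngle b) - 1‖ := by
  have hR : 0 < sin b / b := div_pos (sin_pos_of_pos_of_lt_pi hb hbπ) hb
  set R := sin b / b with hRdef
  set c := b * cot b - 1 with hc
  -- `x = A + c` is large enough for the quadratic term of `exp x` to dominate.
  set x := 1 + 2 / R + 2 * |b - c| + |logLogOfAngle b + c| with hx
  have h2R : 0 < 2 / R := by positivity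
  have hx1 : 1 ≤ x := by
    linarith [abs_nonneg (b - c), abs_nonneg (logLogOfAngle b + c)]
  refine ⟨x - c, ?_, fun s hs => ?_⟩
  · linarith [le_abs_self (logLogOfAngle b + c), abs_nonneg (b - c)]
  have hsim := abs_im_le_of_mem_rectBoundary hb.le hs
  rcases hs with ⟨h1, h2⟩ | ⟨h1 | h1, -⟩
  · exact le_norm_exp_sub_one_of_horizontal hb hbπ h1.1 h2
  · exact le_norm_exp_sub_one_of_re_eq_zero hb hbπ _ h1 hsim
  · have hexp : ‖Complex.exp (s - logLogOfAngle b)‖ = R * Real.exp x := by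
      rw [Complex.norm_exp, Complex.sub_re, Complex.ofReal_re, h1, exp_sub_logLogOfAngle hb hbπ]
      congr 2
      rw [hc]; ring
    have h3 := norm_sub_norm_le (Complex.exp (s - logLogOfAngle b)) 1
    rw [hexp, norm_one] at h3
    have h4 := quadratic_le_exp_of_nonneg (show 0 ≤ x by linarith)
    have h5 : ‖s‖ ≤ |x - c| + b := by
      have := Complex.norm_le_abs_re_add_abs_im s
      rw [h1] at this
      linarith
    have hc0 : c < 0 := by linarith [mul_cot_lt_one hb hbπ]
    rw [abs_of_nonneg (by linarith)] at h5
    have h6 : 2 / R + 2 * (b - c) ≤ x ^ 2 := by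
      nlinarith [le_abs_self (b - c), abs_nonneg (logLogOfAngle b + c)]
    have h7 : R * (2 / R + 2 * (b - c)) ≤ R * x ^ 2 := mul_le_mul_of_nonneg_left h6 hR.le
    have h8 : R * (2 / R) = 2 := by field_simp
    have h9 := mul_le_mul_of_nonneg_left h4 hR.le
    have h10 := mul_le_mul_of_nonneg_left h5 hR.le
    nlinarith

lemma logLogOfAngle_sub (b : ℝ) : logLogOfAngle b - (1 - b * cot b) = -log (sin b / b) := by
  unfold logLogOfAngle; ring

lemma one_sub_mul_cot_le_logLogOfAngle (hb : 0 < b) (hbπ : b < π) :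
    1 - b * cot b ≤ logLogOfAngle b := by
  have h1 : sin b / b ≤ 1 := (div_le_one hb).2 (sin_lt hb).le
  have h2 := log_nonpos (div_pos (sin_pos_of_pos_of_lt_pi hb hbπ) hb).le h1
  linarith [logLogOfAngle_sub b]

lemma antitoneOn_two_mul_cos_add (hb : 0 < b) (hbπ : b < π) :
    AntitoneOn (fun y => 2 * cos y + sin b / b * y ^ 2) (Set.Icc 0 b) := by
  have hd : ∀ y, HasDerivAt (fun y => 2 * cos y + sin b / b * y ^ 2)
      (2 * -sin y + sin b / b * (2 * y)) y := fun y => by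
    simpa using ((hasDerivAt_cos y).const_mul 2).fun_add ((hasDerivAt_pow 2 y).const_mul (sin b / b))
  refine antitoneOn_of_deriv_nonpos (convex_Icc 0 b) (by fun_prop)
    (fun y _ => (hd y).differentiableAt.differentiableWithinAt) fun y hy => ?_
  rw [interior_Icc] at hy
  rw [(hd y).deriv]
  have h1 := mul_sin_le_mul_sin hy.1.le hy.2.le hb hbπ.le
  have h2 : sin b / b * y ≤ sin y := by
    rw [div_mul_eq_mul_div, div_le_iff₀ hb]
    linarith
  linarith

/-- On the vertical segment from the real axis to the critical point, `|ε|` attains its maximum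
`sin b / b` at the critical point. -/
lemma norm_exp_sub_one_le_of_vertical (hb : 0 < b) (hbπ : b < π) {s : ℂ}
    (hre : s.re = 1 - b * cot b) (him : s.im ∈ Set.Icc 0 b) :
    ‖Complex.exp (s - logLogOfAngle b) - 1‖ ≤ sin b / b * ‖s‖ := by
  have hR : 0 < sin b / b := div_pos (sin_pos_of_pos_of_lt_pi hb hbπ) hb
  have h1 := antitoneOn_two_mul_cos_add hb hbπ him (Set.right_mem_Icc.2 hb.le) him.2
  refine le_of_sq_le_sq ?_ (by positivity)
  have hre' : (s - logLogOfAngle b).re = s.re - logLogOfAngle b := by simp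
  have him' : (s - logLogOfAngle b).im = s.im := by simp
  rw [mul_pow, norm_exp_sub_one_sq, norm_sq_eq_re_sq_add_im_sq, hre', him',
    exp_sub_logLogOfAngle hb hbπ, hre, show 1 - b * cot b - 1 + b * cot b = 0 by ring,
    Real.exp_zero, mul_one]
  have h2 := sin_div_mul_mul_cot hb hbπ
  have hRb : sin b / b * b = sin b := div_mul_cancel₀ _ hb.ne'
  simp only at h1
  set R := sin b / b
  set k := b * cot b
  have h3 : R ^ 2 * (1 - k) ^ 2 = R ^ 2 - 2 * R * cos b + 1 - R ^ 2 * b ^ 2 := by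
    have : R ^ 2 * (1 - k) ^ 2 = (R - cos b) ^ 2 := by rw [← h2]; ring
    rw [this, ← mul_pow, hRb]
    linear_combination sin_sq_add_cos_sq b
  have h4 := mul_le_mul_of_nonneg_left h1 hR.le
  nlinarith [sin_sq_add_cos_sq s.im]

lemma norm_exp_sub_one_le_of_real (hb : 0 < b) (hbπ : b < π) {a : ℝ} (h1 : 1 - b * cot b ≤ a)
    (h2 : a ≤ logLogOfAngle b) :
    ‖Complex.exp (a - logLogOfAngle b) - 1‖ ≤ sin b / b * ‖(a : ℂ)‖ := by
  have hR : 0 < sin b / b := div_pos (sin_pos_of_pos_of_lt_pi hb hbπ) hb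
  have key : ∀ t : ℝ, 0 ≤ t → t ≤ logLogOfAngle b →
      ‖Complex.exp (t - logLogOfAngle b) - 1‖ = 1 - Real.exp (t - logLogOfAngle b) ∧
      ‖(t : ℂ)‖ = t := fun t ht0 ht => by
    constructor
    · rw [← Complex.ofReal_sub, ← Complex.ofReal_exp, ← Complex.ofReal_one, ← Complex.ofReal_sub,
        Complex.norm_real, norm_eq_abs, abs_sub_comm, abs_of_nonneg]
      exact sub_nonneg.2 (exp_le_one_iff.2 (by linarith))
    · rw [Complex.norm_real, norm_eq_abs, abs_of_nonneg ht0]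
  have h0 : 0 < 1 - b * cot b := by linarith [mul_cot_lt_one hb hbπ]
  have h3 := norm_exp_sub_one_le_of_vertical hb hbπ (s := ((1 - b * cot b : ℝ) : ℂ))
    (Complex.ofReal_re _) (by rw [Complex.ofReal_im]; exact ⟨le_rfl, hb.le⟩)
  obtain ⟨e1, e2⟩ := key _ h0.le (h1.trans h2)
  obtain ⟨e3, e4⟩ := key a (h0.le.trans h1) h2
  rw [e1, e2] at h3
  rw [e3, e4]
  have h4 := exp_le_exp.2 (show 1 - b * cot b - logLogOfAngle b ≤ a - logLogOfAngle b by linarith)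
  have h5 := mul_le_mul_of_nonneg_left h1 hR.le
  linarith

end angle

/-! ### Convergence and divergence in terms of the Lagrange coefficients -/

lemma sum_Icc_comtetTerm (σ τ : ℝ) (N : ℕ) :
    ∑ n ∈ Finset.Icc 1 N, comtetTerm σ τ n = ∑ n ∈ Finset.range (N + 1), comtetTerm σ τ n := by
  rw [Finset.range_eq_Ico, Finset.sum_eq_sum_Ico_succ_bot (Nat.succ_pos N)]
  simp only [comtetTerm, Finset.Icc_eq_empty_of_lt zero_lt_one, Finset.sum_empty, zero_add]
  rfl

lemma comtetTerm_zero_right (σ : ℝ) (n : ℕ) : comtetTerm σ 0 n = 0 :=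
  Finset.sum_eq_zero fun m hm => by
    rw [zero_pow (by have := (Finset.mem_Icc.1 hm).1; omega)]
    simp

lemma comtetTau_eq (α x : ℝ) : comtetTau α x = comtetSigma α x * log (log x) := by
  unfold comtetTau comtetSigma; ring

lemma comtetConverges_of_norm_le {α x : ℝ} (hσ : 0 ≤ comtetSigma α x) {C q : ℝ} (hq : 0 ≤ q)
    (hσq : comtetSigma α x * q < 1)
    (h : ∀ n : ℕ, ‖lagrangeCoeff (log (log x) : ℝ) n‖ ≤ C * q ^ n) : ComtetConverges α x := by
  have hsum : Summable (comtetTerm (comtetSigma α x) (comtetTau α x)) := by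
    refine Summable.of_norm_bounded_eventually_nat (g := fun n => C * (comtetSigma α x * q) ^ n)
      ((summable_geometric_of_lt_one (mul_nonneg hσ hq) hσq).mul_left C) ?_
    filter_upwards [eventually_ge_atTop 1] with n hn
    rw [comtetTau_eq, norm_eq_abs, abs_comtetTerm _ _ hσ hn, mul_pow]
    have h1 : ‖lagrangeCoeff (log (log x) : ℝ) n‖ / (n + 1) ≤ C * q ^ n :=
      (div_le_self (norm_nonneg _) (by linarith [n.cast_nonneg (α := ℝ)])).trans (h n)
    have h2 := mul_le_mul_of_nonneg_left h1 (pow_nonneg hσ n)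
    linarith
  refine ⟨∑' n, comtetTerm (comtetSigma α x) (comtetTau α x) n, ?_⟩
  simp only [sum_Icc_comtetTerm]
  exact hsum.hasSum.tendsto_sum_nat.comp (tendsto_add_atTop_nat 1)

lemma ComtetConverges.exists_norm_le {α x : ℝ} (hσ : 0 ≤ comtetSigma α x)
    (h : ComtetConverges α x) :
    ∃ M : ℝ, ∀ n : ℕ, ‖lagrangeCoeff (log (log x) : ℝ) n‖ * comtetSigma α x ^ n
      ≤ M * (n + 1) := by
  obtain ⟨s, hs⟩ := h
  obtain ⟨B, hB⟩ := (Metric.isBounded_range_of_tendsto _ hs).exists_norm_le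
  refine ⟨2 * B + ‖lagrangeCoeff (log (log x) : ℝ) 0‖, fun n => ?_⟩
  have hB0 : 0 ≤ B := (norm_nonneg _).trans (hB _ ⟨0, rfl⟩)
  cases n with
  | zero => simpa using hB0
  | succ n =>
    have h1 := hB _ ⟨n + 1, rfl⟩
    have h2 := hB _ ⟨n, rfl⟩
    simp only [sum_Icc_comtetTerm] at h1 h2
    rw [Finset.sum_range_succ] at h1
    have h3 : |comtetTerm (comtetSigma α x) (comtetTau α x) (n + 1)| ≤ 2 * B := by
      rw [norm_eq_abs, abs_le] at h1 h2
      rw [abs_le]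
      constructor <;> linarith
    rw [comtetTau_eq, abs_comtetTerm _ _ hσ (Nat.succ_pos n), ← mul_div_assoc,
      div_le_iff₀ (by positivity)] at h3
    have h4 : 0 ≤ ‖lagrangeCoeff (log (log x) : ℝ) 0‖ * ((n + 1 : ℕ) + 1 : ℝ) := by positivity
    rw [Nat.succ_eq_add_one] at h3
    linarith

lemma norm_log_le_neg_log {y : ℂ} (hy : ‖y - 1‖ < 1) :
    ‖Complex.log y‖ ≤ -log (1 - ‖y - 1‖) := by
  have h1 := Complex.hasSum_taylorSeries_neg_log (z := 1 - y) (by rwa [norm_sub_rev])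
  have h2 := Complex.hasSum_taylorSeries_neg_log (z := (‖y - 1‖ : ℂ)) (by simpa using hy)
  have h3 : HasSum (fun n : ℕ => ‖y - 1‖ ^ n / (n : ℝ)) (-log (1 - ‖y - 1‖)) := by
    have h4 : ((1 : ℂ) - (‖y - 1‖ : ℂ)) = ((1 - ‖y - 1‖ : ℝ) : ℂ) := by push_cast; rfl
    rw [h4, ← Complex.ofReal_log (by linarith)] at h2
    exact_mod_cast h2
  have h5 := h1.norm_le_of_bounded h3 fun n => by
    rw [norm_div, norm_pow, norm_sub_rev, Complex.norm_natCast]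
  rwa [norm_neg, sub_sub_cancel] at h5

/-- Cauchy's estimate on the circle `|y - 1| = r`. -/
lemma norm_lagrangeCoeff_le (p : ℂ) {r : ℝ} (hr : 0 < r) (hr1 : r < 1) (n : ℕ) :
    ‖lagrangeCoeff p n‖ ≤ (‖p‖ - log (1 - r)) * ((‖p‖ - log (1 - r)) / r) ^ n := by
  have hd : DifferentiableOn ℂ (fun y : ℂ => (p + Complex.log y) ^ (n + 1)) (Metric.ball 1 1) :=
    fun y hy => (hasDerivAt_add_log_pow p (n + 1)
      (ball_one_subset_slitPlane hy)).differentiableAt.differentiableWithinAt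
  have h := Complex.norm_iteratedDeriv_le_of_forall_mem_sphere_norm_le n hr
    ((hd.mono ((Metric.closure_ball_subset_closedBall).trans
      (Metric.closedBall_subset_ball hr1))).diffContOnCl)
    (C := (‖p‖ - log (1 - r)) ^ (n + 1)) fun y hy => by
      rw [mem_sphere_iff_norm] at hy
      rw [norm_pow]
      refine pow_le_pow_left₀ (norm_nonneg _) ((norm_add_le _ _).trans ?_) _
      have := norm_log_le_neg_log (y := y) (by rwa [hy])
      rw [hy] at this
      linarith
  have hf : (0 : ℝ) < n.factorial := by exact_mod_cast n.factorial_pos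
  rw [lagrangeCoeff, norm_div, Complex.norm_natCast, div_le_iff₀ hf]
  refine h.trans (le_of_eq ?_)
  rw [div_pow, pow_succ]
  ring

/-! ### The two ranges `log x < 1` and `log x > 1` -/

lemma comtetConverges_of_log_lt_one {α x : ℝ} (hα : 0 < α) (hα1 : α < 1)
    (hL : α * (1 - log α) < log x) (hL1 : log x < 1) : ComtetConverges α x := by
  have hlα := log_neg hα hα1
  have hαL : α < log x := by nlinarith
  have hL0 : 0 < log x := hα.trans hαL
  have hσ : comtetSigma α x = α / log x := rfl
  have hσ0 : 0 < α / log x := div_pos hα hL0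
  have hσ1 : α / log x < 1 := (div_lt_one hL0).2 hαL
  have hp : ‖((log (log x) : ℝ) : ℂ)‖ - log (1 - (1 - α / log x)) = -log α := by
    rw [Complex.norm_real, norm_eq_abs, abs_of_neg (log_neg hL0 hL1), sub_sub_cancel,
      log_div hα.ne' hL0.ne']
    ring
  -- The radius `1 - α / L` minimizes the bound when `x` is at the threshold.
  have h := norm_lagrangeCoeff_le ((log (log x) : ℝ) : ℂ) (r := 1 - α / log x)
    (by linarith) (by linarith)
  rw [hp] at h
  refine comtetConverges_of_norm_le (hσ ▸ hσ0.le) (div_nonneg (by linarith) (by linarith)) ?_ h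
  rw [hσ, ← mul_div_assoc, div_lt_one (by linarith), div_mul_eq_mul_div, one_sub_div hL0.ne']
  exact div_lt_div_of_pos_right (by linarith) hL0

lemma not_comtetConverges_of_log_lt_one {α x : ℝ} (hα : 0 < α) (hL0 : 0 < log x)
    (hL1 : log x < 1) (hL : α < log x → log x < α * (1 - log α)) : ¬ ComtetConverges α x := by
  intro hconv
  have hσ0 : 0 < comtetSigma α x := div_pos hα hL0
  obtain ⟨M, hM⟩ := hconv.exists_norm_le hσ0.le
  have hp := log_neg hL0 hL1
  obtain ⟨v, hv1, hv⟩ := exists_log_add_one_sub_eq hp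
  have hv0 : 0 < v := by linarith
  set p := log (log x) with hpdef
  have hσv : v⁻¹ < comtetSigma α x := by
    rw [comtetSigma, inv_eq_one_div, div_lt_div_iff₀ hv0 hL0, one_mul]
    by_contra! hle
    have hαL : α < log x := by nlinarith
    have hw : v ≤ log x / α := by rw [le_div_iff₀ hα]; linarith
    have hw0 : 0 < log x / α := div_pos hL0 hα
    -- `log t - t` decreases for `t ≥ 1`.
    have h1 := log_le_sub_one_of_pos (div_pos hw0 hv0)
    have h2 : log x / α / v - 1 ≤ log x / α - v := by
      rw [div_sub_one hv0.ne']
      exact div_le_self (by linarith) hv1.le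
    rw [log_div hw0.ne' hv0.ne', log_div hL0.ne' hα.ne'] at h1
    have h3 : 1 - log α ≤ log x / α := by linarith
    rw [le_div_iff₀ hα] at h3
    linarith [hL hαL]
  have hexp : ∀ a : ℝ, v * Real.exp (a - p) = Real.exp (a + v - 1) := fun a => by
    rw [← hv, show a + v - 1 = log v + (a - (log v + 1 - v)) by ring, Real.exp_add,
      Real.exp_log hv0]
  have hvp : 1 - v ≤ p := by linarith [log_pos hv1]
  refine false_of_critical_point (U := Complex.ofReal '' Set.Icc (1 - v) p)
    (s₀ := ((1 - v : ℝ) : ℂ)) (by exact_mod_cast hp.ne) hσ0 hM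
    (isPreconnected_Icc.image _ Complex.continuous_ofReal.continuousOn)
    ⟨p, ⟨hvp, le_rfl⟩, rfl⟩ ⟨1 - v, ⟨le_rfl, hvp⟩, rfl⟩ ?_ ?_
  · rintro _ ⟨a, ⟨ha1, ha2⟩, rfl⟩
    have ha0 : a < 0 := ha2.trans_lt hp
    refine ⟨by exact_mod_cast ha0.ne, lt_of_le_of_lt ?_ hσv⟩
    rw [← Complex.ofReal_sub, ← Complex.ofReal_exp, ← Complex.ofReal_one, ← Complex.ofReal_sub,
      ← Complex.ofReal_div, Complex.norm_real, norm_eq_abs, abs_div, abs_of_neg ha0, abs_sub_comm,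
      abs_of_nonneg (sub_nonneg.2 (exp_le_one_iff.2 (by linarith))), inv_eq_one_div,
      div_le_div_iff₀ (by linarith) hv0]
    have h1 := add_one_le_exp (a + v - 1)
    rw [← hexp] at h1
    linarith
  · have h1 := hexp (1 - v)
    rw [show 1 - v + v - 1 = 0 by ring, Real.exp_zero] at h1
    have h2 : (1 - v) * Real.exp (1 - v - p) = Real.exp (1 - v - p) - 1 := by linarith
    exact_mod_cast h2

lemma sin_div_mul_log_eq {x b : ℝ} (hL1 : 1 < log x) (hb : b ∈ Set.Ioo 0 π)
    (hbx : logLogOfAngle b = log (log x)) :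
    sin b / b * log x = Real.exp (1 - b * cot b) := by
  have hR : 0 < sin b / b := div_pos (sin_pos_of_pos_of_lt_pi hb.1 hb.2) hb.1
  have hL0 : 0 < log x := by linarith
  rw [← Real.exp_log hL0, ← hbx, logLogOfAngle, Real.exp_sub (1 - b * cot b), Real.exp_log hR,
    mul_div_cancel₀ _ hR.ne']

lemma comtetConverges_of_one_lt_log {α x b : ℝ} (hα : 0 < α) (hL1 : 1 < log x)
    (hb : b ∈ Set.Ioo 0 π) (hbx : logLogOfAngle b = log (log x)) (h : b * cot b < 1 - log α) :
    ComtetConverges α x := by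
  have hR : 0 < sin b / b := div_pos (sin_pos_of_pos_of_lt_pi hb.1 hb.2) hb.1
  have hL0 : 0 < log x := by linarith
  obtain ⟨A, hA, hbd⟩ := exists_le_norm_exp_sub_one hb.1 hb.2
  have hp : 0 < logLogOfAngle b := hbx ▸ log_pos hL1
  obtain ⟨C, hC⟩ := exists_norm_lagrangeCoeff_le hb.1 hb.2 hp hA hR hbd
  rw [hbx] at hC
  refine comtetConverges_of_norm_le (div_pos hα hL0).le (inv_nonneg.2 hR.le) ?_ hC
  rw [comtetSigma, ← div_eq_mul_inv, div_lt_one hR, div_lt_iff₀ hL0,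
    sin_div_mul_log_eq hL1 hb hbx, ← log_lt_iff_lt_exp hα]
  linarith

lemma not_comtetConverges_of_one_lt_log {α x b : ℝ} (hα : 0 < α) (hL1 : 1 < log x)
    (hb : b ∈ Set.Ioo 0 π) (hbx : logLogOfAngle b = log (log x)) (h : 1 - log α < b * cot b) :
    ¬ ComtetConverges α x := by
  intro hconv
  have hR : 0 < sin b / b := div_pos (sin_pos_of_pos_of_lt_pi hb.1 hb.2) hb.1
  have hL0 : 0 < log x := by linarith
  have hσ0 : 0 < comtetSigma α x := div_pos hα hL0
  obtain ⟨M, hM⟩ := hconv.exists_norm_le hσ0.le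
  have hp : 0 < logLogOfAngle b := hbx ▸ log_pos hL1
  rw [← hbx] at hM
  have hRσ : sin b / b < comtetSigma α x := by
    rw [comtetSigma, lt_div_iff₀ hL0, sin_div_mul_log_eq hL1 hb hbx, ← lt_log_iff_exp_lt hα]
    linarith
  have ha0 : 0 < 1 - b * cot b := by linarith [mul_cot_lt_one hb.1 hb.2]
  have ha0p := one_sub_mul_cot_le_logLogOfAngle hb.1 hb.2
  set a₀ := 1 - b * cot b with ha₀
  have hbound : ∀ s : ℂ, s ≠ 0 →
      ‖Complex.exp (s - logLogOfAngle b) - 1‖ ≤ sin b / b * ‖s‖ →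
      ‖(Complex.exp (s - logLogOfAngle b) - 1) / s‖ < comtetSigma α x := fun s hs hle => by
    rw [norm_div]
    exact ((div_le_iff₀ (norm_pos_iff.2 hs)).2 hle).trans_lt hRσ
  -- The path runs along the real axis from `p` to `a₀`, then vertically up to `a₀ + b i`.
  refine false_of_critical_point (U := Complex.ofReal '' Set.Icc a₀ (logLogOfAngle b) ∪
      (fun y : ℝ => (a₀ + y * Complex.I : ℂ)) '' Set.Icc 0 b)
    (s₀ := (a₀ + b * Complex.I : ℂ)) (by exact_mod_cast hp.ne') hσ0 hM
    (IsPreconnected.union (a₀ : ℂ) ⟨a₀, ⟨le_rfl, ha0p⟩, rfl⟩ ⟨0, ⟨le_rfl, hb.1.le⟩, by simp⟩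
      (isPreconnected_Icc.image _ Complex.continuous_ofReal.continuousOn)
      (isPreconnected_Icc.image _ (by fun_prop)))
    (Or.inl ⟨logLogOfAngle b, ⟨ha0p, le_rfl⟩, rfl⟩) (Or.inr ⟨b, ⟨hb.1.le, le_rfl⟩, rfl⟩) ?_ ?_
  · rintro _ (⟨a, ⟨ha1, ha2⟩, rfl⟩ | ⟨y, hy, rfl⟩)
    · have hne : (a : ℂ) ≠ 0 := by exact_mod_cast (ha0.trans_le ha1).ne'
      exact ⟨hne, hbound _ hne (norm_exp_sub_one_le_of_real hb.1 hb.2 ha1 ha2)⟩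
    · have hne : (a₀ + y * Complex.I : ℂ) ≠ 0 := fun h0 => by
        have := congrArg Complex.re h0
        simp at this
        exact ha0.ne' this
      exact ⟨hne, hbound _ hne (norm_exp_sub_one_le_of_vertical hb.1 hb.2 (show _ = a₀ by simp)
        (by simpa using hy))⟩
  · -- Here `exp (s₀ - p) = R e^{ib}` and `1 - s₀ = R⁻¹ e^{-ib}`.
    have hRe : Real.exp (a₀ - logLogOfAngle b) = sin b / b := by
      rw [exp_sub_logLogOfAngle hb.1 hb.2, ha₀, show 1 - b * cot b - 1 + b * cot b = 0 by ring,
        Real.exp_zero, mul_one]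
    have hexp : Complex.exp (a₀ + b * Complex.I - logLogOfAngle b)
        = (sin b / b : ℝ) * (Complex.cos b + Complex.sin b * Complex.I) := by
      rw [show (a₀ + b * Complex.I - logLogOfAngle b : ℂ)
        = ((a₀ - logLogOfAngle b : ℝ) : ℂ) + b * Complex.I by push_cast; ring, Complex.exp_add,
        Complex.exp_mul_I, ← Complex.ofReal_exp, hRe]
    have h1 : ((sin b / b : ℝ) : ℂ) * (1 - a₀) = Complex.cos b := by
      have := sin_div_mul_mul_cot hb.1 hb.2
      rw [show b * cot b = 1 - a₀ by rw [ha₀]; ring] at this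
      exact_mod_cast this
    have h2 : ((sin b / b : ℝ) : ℂ) * b = Complex.sin b := by
      have := div_mul_cancel₀ (sin b) hb.1.ne'
      exact_mod_cast this
    rw [hexp]
    linear_combination (-(Complex.cos b + Complex.sin b * Complex.I)) * h1 +
      (Complex.I * (Complex.cos b + Complex.sin b * Complex.I)) * h2
      - Complex.sin_sq_add_cos_sq b + Complex.sin b ^ 2 * Complex.I_sq

/-! ### The threshold -/

lemma log_rpow_threshold {α : ℝ} (hα : 0 < α) :
    log ((Real.exp 1 / α) ^ α) = α * (1 - log α) := by
  rw [log_rpow (by positivity), log_div (by positivity) hα.ne', log_exp]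

lemma mul_one_sub_log_le_one {α : ℝ} (hα : 0 < α) : α * (1 - log α) ≤ 1 := by
  have h := log_le_sub_one_of_pos (inv_pos.2 hα)
  rw [log_inv] at h
  have h1 := mul_le_mul_of_nonneg_left h hα.le
  rw [mul_sub, mul_inv_cancel₀ hα.ne'] at h1
  linarith

lemma log_mul_eq_logLogOfAngle {α η : ℝ} (hα : 0 < α) (hη : IsEtaRoot α η) :
    log (α * (η * (sin η)⁻¹)) = logLogOfAngle η := by
  have hs := sin_pos_of_pos_of_lt_pi hη.1 hη.2.1
  have h1 : η * (sin η)⁻¹ = (sin η / η)⁻¹ := by rw [inv_div, div_eq_mul_inv]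
  have h2 : 0 < sin η / η := div_pos hs hη.1
  rw [h1, log_mul hα.ne' (inv_pos.2 h2).ne', log_inv, logLogOfAngle, hη.2.2]
  ring

lemma one_lt_comtetThreshold_exponent {α η : ℝ} (hα : 1 < α) (hη : IsEtaRoot α η) :
    1 < α * (η * (sin η)⁻¹) := by
  have hs := sin_pos_of_pos_of_lt_pi hη.1 hη.2.1
  have h1 : 1 ≤ η * (sin η)⁻¹ := by
    rw [← div_eq_mul_inv, one_le_div hs]
    exact (sin_lt hη.1).le
  nlinarith

lemma one_lt_comtetThreshold {α η : ℝ} (hα : 0 < α) (hη : 1 < α → IsEtaRoot α η) :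
    1 < comtetThreshold α η := by
  unfold comtetThreshold
  split_ifs with h
  · refine one_lt_rpow ?_ hα
    rw [one_lt_div hα]
    linarith [add_one_lt_exp (one_ne_zero (α := ℝ))]
  · have hα1 := not_le.1 h
    exact one_lt_exp_iff.2 (zero_lt_one.trans (one_lt_comtetThreshold_exponent hα1 (hη hα1)))

lemma comtetConverges_of_threshold_lt {α η x : ℝ} (hα : 0 < α) (hη : 1 < α → IsEtaRoot α η)
    (hx : comtetThreshold α η < x) : ComtetConverges α x := by
  have hx1 : 1 < x := (one_lt_comtetThreshold hα hη).trans hx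
  rcases le_or_gt α 1 with h1 | h1
  · rw [comtetThreshold, if_pos h1] at hx
    have hL : α * (1 - log α) < log x := by
      rw [← log_rpow_threshold hα]
      exact log_lt_log (by positivity) hx
    have hlα := log_nonpos hα.le h1
    rcases lt_trichotomy (log x) 1 with h | h | h
    · refine comtetConverges_of_log_lt_one hα (h1.lt_of_ne fun h0 => ?_) hL h
      rw [h0, log_one] at hL
      linarith
    · -- At `x = e` all terms vanish.
      refine ⟨0, ?_⟩
      have h0 : comtetTau α x = 0 := by rw [comtetTau, h, log_one]; simp
      simp only [h0, comtetTerm_zero_right, Finset.sum_const_zero]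
      exact tendsto_const_nhds
    · obtain ⟨b, hb, hbx⟩ := exists_logLogOfAngle_eq (log_pos h)
      exact comtetConverges_of_one_lt_log hα h hb hbx
        (by linarith [mul_cot_lt_one hb.1 hb.2])
  · have hr := hη h1
    rw [comtetThreshold, if_neg (not_le.2 h1)] at hx
    have hL : α * (η * (sin η)⁻¹) < log x := (lt_log_iff_exp_lt (by linarith)).2 hx
    have he := one_lt_comtetThreshold_exponent h1 hr
    have hL1 := he.trans hL
    obtain ⟨b, hb, hbx⟩ := exists_logLogOfAngle_eq (log_pos hL1)
    refine comtetConverges_of_one_lt_log hα hL1 hb hbx ?_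
    have hlt : logLogOfAngle η < logLogOfAngle b := by
      rw [hbx, ← log_mul_eq_logLogOfAngle hα hr]
      exact log_lt_log (by linarith) hL
    have hηb : η < b := not_le.1 fun hle =>
      absurd (monotoneOn_logLogOfAngle hb ⟨hr.1, hr.2.1⟩ hle) (not_le.2 hlt)
    have := strictAntiOn_mul_cot ⟨hr.1, hr.2.1⟩ hb hηb
    simp only at this
    rwa [hr.2.2] at this

lemma not_comtetConverges_of_lt_threshold {α η x : ℝ} (hα : 0 < α) (hη : 1 < α → IsEtaRoot α η)
    (hx1 : 1 < x) (hx : x < comtetThreshold α η) (hxe : x ≠ Real.exp 1) :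
    ¬ ComtetConverges α x := by
  have hL0 : 0 < log x := log_pos hx1
  rcases le_or_gt α 1 with h1 | h1
  · rw [comtetThreshold, if_pos h1] at hx
    have hL : log x < α * (1 - log α) := by
      rw [← log_rpow_threshold hα]
      exact log_lt_log (by linarith) hx
    exact not_comtetConverges_of_log_lt_one hα hL0 (hL.trans_le (mul_one_sub_log_le_one hα))
      fun _ => hL
  · have hr := hη h1
    rw [comtetThreshold, if_neg (not_le.2 h1)] at hx
    have hL : log x < α * (η * (sin η)⁻¹) := (log_lt_iff_lt_exp (by linarith)).2 hx
    rcases lt_trichotomy (log x) 1 with h | h | h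
    · exact not_comtetConverges_of_log_lt_one hα hL0 h fun h' => by linarith
    · exact absurd (by rw [← h, exp_log (by linarith)]) hxe
    · obtain ⟨b, hb, hbx⟩ := exists_logLogOfAngle_eq (log_pos h)
      refine not_comtetConverges_of_one_lt_log hα h hb hbx ?_
      have hlt : logLogOfAngle b < logLogOfAngle η := by
        rw [hbx, ← log_mul_eq_logLogOfAngle hα hr]
        exact log_lt_log (by linarith) hL
      have hηb : b < η := not_le.1 fun hle =>
        absurd (monotoneOn_logLogOfAngle ⟨hr.1, hr.2.1⟩ hb hle) (not_le.2 hlt)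
      have := strictAntiOn_mul_cot hb ⟨hr.1, hr.2.1⟩ hηb
      simp only at this
      rwa [hr.2.2] at this

lemma comtetThreshold_one (η : ℝ) : comtetThreshold 1 η = Real.exp 1 := by
  simp [comtetThreshold]

theorem mainTheorem2 :
    -- for `α > 1` the number `η₀` exists and is unique
    (∀ α : ℝ, 1 < α → ∃! η₀ : ℝ, IsEtaRoot α η₀) ∧
    -- the domain of convergence for real `α > 0`
    (∀ α η₀ : ℝ, 0 < α → (1 < α → IsEtaRoot α η₀) →
      1 < comtetThreshold α η₀ ∧
      (∀ x : ℝ, comtetThreshold α η₀ < x → ComtetConverges α x) ∧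
      (∀ x : ℝ, 1 < x → x < comtetThreshold α η₀ → x ≠ exp 1 → ¬ ComtetConverges α x)) ∧
    -- at the exceptional point `x = e` all terms vanish
    (∀ α : ℝ, 0 < α → ∀ n : ℕ, 1 ≤ n →
      comtetTerm (comtetSigma α (exp 1)) (comtetTau α (exp 1)) n = 0) ∧
    -- the case `α = 1` of the Lambert function
    (∀ x : ℝ, exp 1 < x → ComtetConverges 1 x) ∧
    (∀ x : ℝ, 1 < x → x < exp 1 → ¬ ComtetConverges 1 x) := by
  have h1 : ∀ η : ℝ, (1 : ℝ) < 1 → IsEtaRoot 1 η := fun _ h => absurd h (lt_irrefl 1)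
  refine ⟨fun α hα => existsUnique_isEtaRoot hα, fun α η hα hη =>
    ⟨one_lt_comtetThreshold hα hη, fun x hx => comtetConverges_of_threshold_lt hα hη hx,
      fun x hx1 hx hxe => not_comtetConverges_of_lt_threshold hα hη hx1 hx hxe⟩,
    fun α _ n _ => ?_, fun x hx => ?_, fun x hx1 hx => ?_⟩
  · rw [comtetTau, log_exp, log_one, mul_zero, zero_div, comtetTerm_zero_right]
  · exact comtetConverges_of_threshold_lt zero_lt_one (h1 0) (by rwa [comtetThreshold_one])
  · exact not_comtetConverges_of_lt_threshold zero_lt_one (h1 0) hx1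
      (by rwa [comtetThreshold_one]) hx.ne
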